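/- **Theorem.** Let $n\ge 1$ and let $\mathbf{Br}_n^+$ be the positive braid monoid, generated by $\sigma_1,\dots,\sigma_{n-1}$ with the relations $\sigma_i\sigma_j=\sigma_j\sigma_i$ for $|i-j|>1$ and $\sigma_i\sigma_{i+1}\sigma_i=\sigma_{i+1}\sigma_i\sigma_{i+1}$. A positive braid is *non-repeating* if any two of its strands cross at most once; let $D\subset\mathbf{Br}_n^+$ be the set of non-repeating braids. Permutations of $\{1,\dots,n\}$ are multiplied from left to right ($ab$ is first $a$, then $b$). For $\pi\in\mathbb S_n$ let $R_\pi$ be the non-repeating braid whose strands go from the top endpoint $i$ to the bottom endpoint $\pi(i)$ for all $i$, and write $R_\pi$ also for the set $\{(i,j): i<j,\ \pi(i)>\pi(j)\}$ of its crossings. Let $\wedge$ be the meet in the lattice $\mathbb S_n$ ordered by $\pi_1\le\pi_2\iff R_{\pi_1}\subseteq R_{\pi_2}$ (so $\pi_1\wedge\pi_2$ is the largest permutation below $\pi_1$ and $\pi_2$), let $\omega(i)=n+1-i$, and put $$R_a\asymp R_b:=R_{a(a^{-1}\wedge b\omega)},\qquad R_a\bowtie R_b:=R_{(a^{-1}\wedge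 b\omega)^{-1}b}.$$ Order $D$ deg-lexicographically: compare first the numbers of crossings $|R_\pi|$, then the lexicographically sorted lists of the pairs in $R_\pi$ lexicographically. Order the words in non-repeating braids deg-lexicographically with respect to this order $\preceq$ on the letters; the trivial braid $R_\varepsilon=1$ is written as the empty word, so the letters are the elements of $X=D\setminus\{R_\varepsilon\}$. Then the set of relations $$\mathcal R=\{R_aR_b=(R_a\asymp R_b)(R_a\bowtie R_b)\;:\;R_a,R_b\in D\}$$ is a Gröbner–Shirshov basis of the monoid $\mathbf{Br}_n^+$ in the generators $X$. That is: $X$ generates $\mathbf{Br}_n^+$, and $\mathcal R$ is a set of defining relations on these generators; the order on words is a monomial order (a well-order compatible with multiplication); in each relation whose two sides are different words, the left side is the larger one; and for every field $k$, all compositions (of intersection and of inclusion) of the nonzero polynomials $u-v\in k\langle X\rangle$, for $u=v$ in $\mathcal R$, are trivial modulo these polynomials and the word of the composition. -/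

import Mathlib

namespace ThurstonBraid

/-! ### Groebner - Shirshov bases in free associative algebras

`MonoidAlgebra k (FreeMonoid X)` is the free associative algebra `k⟨X⟩`; its basis is the set
`FreeMonoid X` of words. -/

section GroebnerShirshov

variable {k : Type*} [Field k] {X : Type*}

/-- A monomial order: a strict total well-order on words, compatible with multiplication. -/
structure IsMonomialOrder (lt : FreeMonoid X → FreeMonoid X → Prop) : Prop where
  total : IsStrictTotalOrder (FreeMonoid X) lt
  wf : WellFounded lt
  mul : ∀ a b u v, lt u v → lt (a * u * b) (a * v * b)

/-- `w` is the leading word of the polynomial `f`. -/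
def IsLeadingWord (lt : FreeMonoid X → FreeMonoid X → Prop)
    (f : MonoidAlgebra k (FreeMonoid X)) (w : FreeMonoid X) : Prop :=
  f.coeff w ≠ 0 ∧ ∀ u, f.coeff u ≠ 0 → u ≠ w → lt u w

/-- A word, as a monomial with coefficient one. -/
noncomputable def mon (k : Type*) [Field k] (u : FreeMonoid X) : MonoidAlgebra k (FreeMonoid X) :=
  MonoidAlgebra.of k (FreeMonoid X) u

/-- `h` is trivial modulo `(S, w)`: it is a linear combination of polynomials `a s b` with
`s ∈ S`, `a`, `b` words, whose leading words `a s̄ b` are smaller than `w`. -/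
def TrivialMod (lt : FreeMonoid X → FreeMonoid X → Prop)
    (S : Set (MonoidAlgebra k (FreeMonoid X))) (w : FreeMonoid X)
    (h : MonoidAlgebra k (FreeMonoid X)) : Prop :=
  h ∈ Submodule.span k {g | ∃ s ∈ S, ∃ a u b, IsLeadingWord lt s u ∧ lt (a * u * b) w ∧
    g = mon k a * s * mon k b}

/-- `S` is a Groebner - Shirshov basis (of the ideal it generates) with respect to the monomial
order `lt`: it consists of monic polynomials, and all compositions of intersection and of inclusion
of its elements are trivial. -/
structure IsGroebnerShirshovBasis (lt : FreeMonoid X → FreeMonoid X → Prop)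
    (S : Set (MonoidAlgebra k (FreeMonoid X))) : Prop where
  order : IsMonomialOrder lt
  monic : ∀ f ∈ S, ∃ u, IsLeadingWord lt f u ∧ f.coeff u = 1
  intersection : ∀ f ∈ S, ∀ g ∈ S, ∀ u v a b w,
    IsLeadingWord lt f u → IsLeadingWord lt g v → w = u * b → w = a * v →
    w.length < u.length + v.length → TrivialMod lt S w (f * mon k b - mon k a * g)
  inclusion : ∀ f ∈ S, ∀ g ∈ S, ∀ u v a b,
    IsLeadingWord lt f u → IsLeadingWord lt g v → u = a * v * b →
    TrivialMod lt S u (f - mon k a * g * mon k b)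

/-- The nonzero binomials `u - v` of a set of relations `u = v` between words. -/
def binomials (k : Type*) [Field k] (rels : FreeMonoid X → FreeMonoid X → Prop) :
    Set (MonoidAlgebra k (FreeMonoid X)) :=
  {f | ∃ u v, rels u v ∧ u ≠ v ∧ f = mon k u - mon k v}

/-- The relations `rels` are a Groebner - Shirshov basis of the monoid `M`, generated by the images
of the letters `X` under `φ`: they are a presentation of `M` on these generators, each
nontrivial relation `u = v` has the leading word `u`, and the binomials `u - v` are a
Groebner - Shirshov basis in `k⟨X⟩`. -/
structure IsGroebnerShirshovBasisOfMonoid (k : Type*) [Field k] {M : Type*} [Monoid M]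
    (φ : X → M) (lt : FreeMonoid X → FreeMonoid X → Prop)
    (rels : FreeMonoid X → FreeMonoid X → Prop) : Prop where
  generates : Function.Surjective (FreeMonoid.lift φ)
  presents : ∀ u v, FreeMonoid.lift φ u = FreeMonoid.lift φ v ↔ conGen rels u v
  oriented : ∀ u v, rels u v → u ≠ v → lt v u
  basis : IsGroebnerShirshovBasis lt (binomials k rels)

end GroebnerShirshov

variable {n : ℕ}

/-! ### Permutations

A permutation `π` sends the top endpoint of a strand to its bottom endpoint. "First `a`, then `b`"
is `b * a` in Mathlib. -/

/-- The set `R_π` of pairs `i < j` with `π i > π j`. -/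
def inversions (π : Equiv.Perm (Fin n)) : Finset (Fin n × Fin n) :=
  Finset.univ.filter fun q => q.1 < q.2 ∧ π q.2 < π q.1

theorem mem_inversions {π : Equiv.Perm (Fin n)} {q : Fin n × Fin n} :
    q ∈ inversions π ↔ q.1 < q.2 ∧ π q.2 < π q.1 := by
  simp [inversions]

/-- `x` is the largest permutation below `a` and `b`, for the order `π₁ ≤ π₂ ↔ R_π₁ ⊆ R_π₂`. -/
def IsMeet (a b x : Equiv.Perm (Fin n)) : Prop :=
  inversions x ⊆ inversions a ∧ inversions x ⊆ inversions b ∧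
    ∀ y, inversions y ⊆ inversions a → inversions y ⊆ inversions b → inversions y ⊆ inversions x

theorem exists_perm_of_order (r : Fin n → Fin n → Prop) (irr : ∀ i, ¬ r i i)
    (tr : ∀ i j l, r i j → r j l → r i l) (tot : ∀ i j, i ≠ j → r i j ∨ r j i) :
    ∃ x : Equiv.Perm (Fin n), ∀ i j, r i j ↔ x i < x j := by
  classical
  let c : Fin n → ℕ := fun i => (Finset.univ.filter fun j => r j i).card
  have hc : ∀ i, c i < n := fun i => by
    have : (Finset.univ.filter fun j => r j i) ⊂ (Finset.univ : Finset (Fin n)) := by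
      rw [Finset.ssubset_univ_iff]
      intro h
      have := h ▸ Finset.mem_univ i
      exact irr i (by simpa using this)
    simpa using Finset.card_lt_card this
  have hm : ∀ i j, r i j → c i < c j := fun i j h => by
    apply Finset.card_lt_card
    refine ⟨fun l hl => ?_, fun hs => ?_⟩
    · simp only [Finset.mem_filter, Finset.mem_univ, true_and] at hl ⊢
      exact tr _ _ _ hl h
    · have := hs (show i ∈ _ by simpa using h)
      exact irr i (by simpa using this)
  let f : Fin n → Fin n := fun i => ⟨c i, hc i⟩
  have hf : Function.Injective f := fun i j h => by
    by_contra hne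
    have h' : c i = c j := congrArg Fin.val h
    rcases tot i j hne with h1 | h1
    · have := hm _ _ h1; omega
    · have := hm _ _ h1; omega
  refine ⟨Equiv.ofBijective f (Finite.injective_iff_bijective.1 hf), fun i j => ⟨hm i j, fun h => ?_⟩⟩
  have h' : c i < c j := h
  by_contra hr
  by_cases hij : i = j
  · subst hij; omega
  · rcases tot i j hij with h1 | h1
    · exact hr h1
    · have := hm _ _ h1; omega

theorem exists_isMeet (a b : Equiv.Perm (Fin n)) : ∃ x, IsMeet a b x := by
  classical
  let s : Fin n → Fin n → Prop := fun i j => i < j ∧ (a i < a j ∨ b i < b j)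
  let t : Fin n → Fin n → Prop := Relation.TransGen s
  have tlt : ∀ i j, t i j → i < j := fun i j h => by
    induction h with
    | single h => exact h.1
    | tail _ h ih => exact ih.trans h.1
  have split : ∀ i l, t i l → ∀ j, i < j → j < l → t i j ∨ t j l := fun i l h => by
    induction h with
    | @single l h =>
      intro j hij hjl
      rcases h.2 with h | h
      · rcases lt_or_ge (a i) (a j) with h1 | h1
        · exact Or.inl (.single ⟨hij, Or.inl h1⟩)
        · exact Or.inr (.single ⟨hjl, Or.inl (h1.trans_lt h)⟩)
      · rcases lt_or_ge (b i) (b j) with h1 | h1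
        · exact Or.inl (.single ⟨hij, Or.inr h1⟩)
        · exact Or.inr (.single ⟨hjl, Or.inr (h1.trans_lt h)⟩)
    | @tail m l him hml ih =>
      intro j hij hjl
      rcases lt_trichotomy j m with h | h | h
      · exact (ih j hij h).imp id fun h' => h'.tail hml
      · subst h; exact Or.inl him
      · rcases hml.2 with h' | h'
        · rcases lt_or_ge (a m) (a j) with h1 | h1
          · exact Or.inl (him.tail ⟨h, Or.inl h1⟩)
          · exact Or.inr (.single ⟨hjl, Or.inl (h1.trans_lt h')⟩)
        · rcases lt_or_ge (b m) (b j) with h1 | h1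
          · exact Or.inl (him.tail ⟨h, Or.inr h1⟩)
          · exact Or.inr (.single ⟨hjl, Or.inr (h1.trans_lt h')⟩)
  have ttr : ∀ i j l, t i j → t j l → t i l := fun i j l h h' => Relation.TransGen.trans h h'
  obtain ⟨x, hx⟩ := exists_perm_of_order (fun i j => t i j ∨ (j < i ∧ ¬ t j i))
    (fun i h => by
      rcases h with h | h
      · exact lt_irrefl _ (tlt _ _ h)
      · exact lt_irrefl _ h.1)
    (fun i j l h h' => by
      rcases h with h | ⟨h1, h2⟩ <;> rcases h' with h' | ⟨h3, h4⟩
      · exact Or.inl (ttr _ _ _ h h')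
      · rcases lt_trichotomy i l with h5 | h5 | h5
        · rcases split _ _ h l h5 h3 with h6 | h6
          · exact Or.inl h6
          · exact absurd h6 h4
        · subst h5; exact absurd h h4
        · exact Or.inr ⟨h5, fun h6 => h4 (ttr _ _ _ h6 h)⟩
      · rcases lt_trichotomy i l with h5 | h5 | h5
        · rcases split _ _ h' i h1 h5 with h6 | h6
          · exact absurd h6 h2
          · exact Or.inl h6
        · subst h5; exact absurd h' h2
        · exact Or.inr ⟨h5, fun h6 => h2 (ttr _ _ _ h' h6)⟩
      · refine Or.inr ⟨h3.trans h1, fun h6 => ?_⟩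
        rcases split _ _ h6 j h3 h1 with h7 | h7
        · exact h4 h7
        · exact h2 h7)
    (fun i j hij => by
      rcases lt_or_gt_of_ne hij with h | h
      · by_cases h' : t i j
        · exact Or.inl (Or.inl h')
        · exact Or.inr (Or.inr ⟨h, h'⟩)
      · by_cases h' : t j i
        · exact Or.inr (Or.inl h')
        · exact Or.inl (Or.inr ⟨h, h'⟩))
  have key : ∀ i j, i < j → (x j < x i ↔ ¬ t i j) := fun i j hij => by
    rw [← hx j i]
    exact ⟨fun h => h.elim (fun h => absurd (tlt _ _ h) hij.not_gt) fun h => h.2,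
      fun h => Or.inr ⟨hij, h⟩⟩
  refine ⟨x, fun q hq => ?_, fun q hq => ?_, fun y hya hyb q hq => ?_⟩
  · rw [mem_inversions] at hq ⊢
    refine ⟨hq.1, ?_⟩
    have h := (key _ _ hq.1).1 hq.2
    by_contra hn
    exact h (.single ⟨hq.1, Or.inl (lt_of_le_of_ne (not_lt.1 hn)
      fun e => hq.1.ne (a.injective e))⟩)
  · rw [mem_inversions] at hq ⊢
    refine ⟨hq.1, ?_⟩
    have h := (key _ _ hq.1).1 hq.2
    by_contra hn
    exact h (.single ⟨hq.1, Or.inr (lt_of_le_of_ne (not_lt.1 hn)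
      fun e => hq.1.ne (b.injective e))⟩)
  · rw [mem_inversions] at hq ⊢
    refine ⟨hq.1, (key _ _ hq.1).2 fun h => hq.2.not_gt ?_⟩
    have step : ∀ i j, s i j → y i < y j := fun i j hs => by
      by_contra hn
      have hy : y j < y i := lt_of_le_of_ne (not_lt.1 hn) fun e => hs.1.ne' (y.injective e)
      have h1 := mem_inversions.1 (hya (mem_inversions.2 ⟨hs.1, hy⟩ : (i, j) ∈ inversions y))
      have h2 := mem_inversions.1 (hyb (mem_inversions.2 ⟨hs.1, hy⟩ : (i, j) ∈ inversions y))
      exact hs.2.elim h1.2.not_gt h2.2.not_gt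
    have gen : ∀ i j, t i j → y i < y j := fun i j h => by
      induction h with
      | single h => exact step _ _ h
      | tail _ h ih => exact ih.trans (step _ _ h)
    exact gen _ _ h

/-- The meet `a ∧ b` in the lattice of permutations. -/
noncomputable def meet (a b : Equiv.Perm (Fin n)) : Equiv.Perm (Fin n) :=
  Classical.choose (exists_isMeet a b)

theorem meet_spec (a b : Equiv.Perm (Fin n)) : IsMeet a b (meet a b) :=
  Classical.choose_spec (exists_isMeet a b)

/-- The complement `¬ π`, first `π` and then the reversal `i ↦ n + 1 - i`; `R_{¬π}` is the set of
all pairs `i < j` that are not in `R_π`. -/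
def compl (π : Equiv.Perm (Fin n)) : Equiv.Perm (Fin n) := Fin.revPerm * π

theorem mem_inversions_compl {π : Equiv.Perm (Fin n)} {q : Fin n × Fin n} :
    q ∈ inversions (compl π) ↔ q.1 < q.2 ∧ q ∉ inversions π := by
  simp only [mem_inversions, compl, Equiv.Perm.coe_mul, Function.comp, Fin.revPerm_apply,
    Fin.rev_lt_rev, not_and, not_lt]
  constructor
  · exact fun h => ⟨h.1, fun _ => h.2.le⟩
  · exact fun h => ⟨h.1, lt_of_le_of_ne (h.2 h.1) fun e => h.1.ne (π.injective e)⟩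

/-! ### Positive braids -/

/-- The left position `i` of the crossing `σ_i` of the strands in the positions `i`, `i + 1`. -/
def posL (i : Fin (n - 1)) : Fin n := ⟨i, by omega⟩

/-- The right position `i + 1` of the crossing `σ_i`. -/
def posR (i : Fin (n - 1)) : Fin n := ⟨i + 1, by omega⟩

/-- The transposition `s_i = (i, i + 1)`. -/
def adj (i : Fin (n - 1)) : Equiv.Perm (Fin n) := Equiv.swap (posL i) (posR i)

/-- The defining relations of the positive braid monoid. -/
inductive BraidRel (n : ℕ) : FreeMonoid (Fin (n - 1)) → FreeMonoid (Fin (n - 1)) → Prop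
  | comm (i j : Fin (n - 1)) (h : (i : ℕ) + 1 < j) :
      BraidRel n (FreeMonoid.of i * FreeMonoid.of j) (FreeMonoid.of j * FreeMonoid.of i)
  | braid (i j : Fin (n - 1)) (h : (i : ℕ) + 1 = j) :
      BraidRel n (FreeMonoid.of i * FreeMonoid.of j * FreeMonoid.of i)
        (FreeMonoid.of j * FreeMonoid.of i * FreeMonoid.of j)

/-- The positive braid monoid on `n` strands. -/
abbrev BraidMonoid (n : ℕ) : Type := PresentedMonoid (BraidRel n)

/-- The positive braid represented by a word in the crossings, read from top to bottom. -/
def ofWord (w : List (Fin (n - 1))) : BraidMonoid n :=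
  PresentedMonoid.mk (BraidRel n) (FreeMonoid.ofList w)

/-- The permutation of a braid word: the strand with top endpoint `s` has bottom endpoint
`wordPerm w s`. -/
def wordPerm : List (Fin (n - 1)) → Equiv.Perm (Fin n)
  | [] => 1
  | i :: w => wordPerm w * adj i

/-- The number of crossings, in a braid word, of the strands with top endpoints `s` and `t`. -/
def crossings : List (Fin (n - 1)) → Fin n → Fin n → ℕ
  | [], _, _ => 0
  | i :: w, s, t =>
    (if s(s, t) = s(posL i, posR i) then 1 else 0) + crossings w (adj i s) (adj i t)

/-- A braid word is non-repeating if any two of its strands cross at most once. -/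
def NonRepeatingWord (w : List (Fin (n - 1))) : Prop :=
  ∀ s t : Fin n, s ≠ t → crossings w s t ≤ 1

/-- The set `D` of the classes of non-repeating positive braids. -/
def D (n : ℕ) : Set (BraidMonoid n) := {x | ∃ w, ofWord w = x ∧ NonRepeatingWord w}

theorem adj_comm (i j : Fin (n - 1)) (h : (i : ℕ) + 1 < j) : adj j * adj i = adj i * adj j := by
  have h1 : posL i ≠ posL j := fun e => by have := congrArg Fin.val e; simp [posL] at this; omega
  have h2 : posL i ≠ posR j := fun e => by
    have := congrArg Fin.val e; simp [posL, posR] at this; omega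
  have h3 : posR i ≠ posL j := fun e => by
    have := congrArg Fin.val e; simp [posL, posR] at this; omega
  have h4 : posR i ≠ posR j := fun e => by
    have := congrArg Fin.val e; simp [posR] at this; omega
  ext s : 1
  simp only [adj, Equiv.Perm.coe_mul, Function.comp, Equiv.swap_apply_def]
  grind

theorem adj_braid (i j : Fin (n - 1)) (h : (i : ℕ) + 1 = j) :
    adj i * (adj j * adj i) = adj j * (adj i * adj j) := by
  have h1 : posR i = posL j := Fin.ext h
  have h2 : posL i ≠ posL j := fun e => by have := congrArg Fin.val e; simp [posL] at this; omega
  have h3 : posL i ≠ posR j := fun e => by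
    have := congrArg Fin.val e; simp [posL, posR] at this; omega
  have h4 : posL j ≠ posR j := fun e => by
    have := congrArg Fin.val e; simp [posL, posR] at this
  ext s : 1
  simp only [adj, h1, Equiv.Perm.coe_mul, Function.comp, Equiv.swap_apply_def]
  grind

/-- The homomorphism `p` to permutations; `MulOpposite` because the product of braids corresponds
to the composition "first the upper braid, then the lower one". -/
def permHom : BraidMonoid n →* (Equiv.Perm (Fin n))ᵐᵒᵖ :=
  PresentedMonoid.lift (fun i => MulOpposite.op (adj i)) (by
    intro u v h
    induction h with
    | comm i j h =>
      simp only [map_mul, FreeMonoid.lift_eval_of, ← MulOpposite.op_mul]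
      rw [adj_comm i j h]
    | braid i j h =>
      simp only [map_mul, FreeMonoid.lift_eval_of, ← MulOpposite.op_mul]
      rw [adj_braid i j h])

/-- The permutation `p(x)` of a positive braid. -/
def perm (x : BraidMonoid n) : Equiv.Perm (Fin n) := (permHom x).unop

theorem ofWord_cons (i : Fin (n - 1)) (w : List (Fin (n - 1))) :
    ofWord (i :: w) = PresentedMonoid.of (BraidRel n) i * ofWord w := rfl

theorem perm_ofWord (w : List (Fin (n - 1))) : perm (ofWord w) = wordPerm w := by
  induction w with
  | nil => rfl
  | cons i w ih =>
    rw [ofWord_cons, wordPerm, ← ih, perm, map_mul, MulOpposite.unop_mul]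
    rfl

theorem adj_lt {i : Fin (n - 1)} {s t : Fin n} (h : s < t)
    (hne : s(s, t) ≠ s(posL i, posR i)) : adj i s < adj i t := by
  have h5 : ¬ (s = posL i ∧ t = posR i) := fun e => hne (by rw [e.1, e.2])
  obtain ⟨hv, hv'⟩ : (posL i).val = i ∧ (posR i).val = i + 1 := ⟨rfl, rfl⟩
  rw [Fin.ext_iff, Fin.ext_iff] at h5
  rw [Fin.lt_def] at h ⊢
  simp only [adj, Equiv.swap_apply_def, Fin.ext_iff]
  split_ifs <;> omega

theorem exists_descent (π : Equiv.Perm (Fin n)) (h : ∀ i : Fin (n - 1), π (posL i) < π (posR i)) :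
    ∀ s t : Fin n, s < t → π s < π t := by
  rcases n with _ | m
  · exact fun s => s.elim0
  · intro s t hst
    have hs : StrictMono (π : Fin (m + 1) → Fin (m + 1)) := by
      rw [Fin.strictMono_iff_lt_succ]
      intro i
      exact h i
    exact hs hst

theorem exists_word (N : ℕ) : ∀ π : Equiv.Perm (Fin n), (inversions π).card = N →
    ∃ w : List (Fin (n - 1)), wordPerm w = π ∧
      ∀ s t, s < t → (crossings w s t = if π t < π s then 1 else 0) ∧
        crossings w t s = crossings w s t := by
  induction N using Nat.strong_induction_on with
  | _ N ih =>
    intro π hN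
    by_cases hd : ∀ i : Fin (n - 1), π (posL i) < π (posR i)
    · have hm := exists_descent π hd
      refine ⟨[], ?_, fun s t hst => ⟨?_, rfl⟩⟩
      · have hs : StrictMono π := fun s t h => hm s t h
        have : (hs.orderIsoOfSurjective π π.surjective) = OrderIso.refl (Fin n) :=
          Subsingleton.elim _ _
        ext s : 1
        exact (congrArg (fun f : Fin n ≃o Fin n => f s) this).symm
      · simp [crossings, (hm s t hst).not_gt]
    · push Not at hd
      obtain ⟨i, hi⟩ := hd
      have hlr : posL i < posR i := by simp [posL, posR, Fin.lt_def]
      have hi' : π (posR i) < π (posL i) := lt_of_le_of_ne hi fun e => hlr.ne' (π.injective e)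
      have hadj : ∀ s, adj i (adj i s) = s := fun s => by simp [adj]
      have hπ : ∀ s, (π * adj i) (adj i s) = π s := fun s => by
        simp only [Equiv.Perm.coe_mul, Function.comp, hadj]
      have hL : adj i (posL i) = posR i := by simp [adj]
      have hR : adj i (posR i) = posL i := by simp [adj]
      have hcard : (inversions (π * adj i)).card < N := by
        rw [← hN, ← Finset.card_image_of_injective (inversions (π * adj i))
          (f := fun q : Fin n × Fin n => (adj i q.1, adj i q.2))
          (fun q r e => by
            simp only [Prod.mk.injEq, EmbeddingLike.apply_eq_iff_eq] at e
            exact Prod.ext e.1 e.2)]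
        apply Finset.card_lt_card
        have hne : ∀ s t, (s, t) ∈ inversions (π * adj i) → s(s, t) ≠ s(posL i, posR i) := by
          intro s t h e
          rw [mem_inversions] at h
          rcases Sym2.eq_iff.1 e with ⟨rfl, rfl⟩ | ⟨rfl, rfl⟩
          · have := h.2
            simp only [Equiv.Perm.coe_mul, Function.comp, hL, hR] at this
            exact this.not_gt hi'
          · exact h.1.not_gt hlr
        refine ⟨fun q hq => ?_, fun hs => ?_⟩
        · obtain ⟨⟨s, t⟩, h, rfl⟩ := Finset.mem_image.1 hq
          have h1 := hne s t h
          rw [mem_inversions] at h ⊢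
          exact ⟨adj_lt h.1 h1, h.2⟩
        · have h0 : (posL i, posR i) ∈ inversions π := mem_inversions.2 ⟨hlr, hi'⟩
          obtain ⟨⟨s, t⟩, h, e⟩ := Finset.mem_image.1 (hs h0)
          simp only [Prod.mk.injEq] at e
          have e1 : s = posR i := by rw [← hadj s, e.1, hL]
          have e2 : t = posL i := by rw [← hadj t, e.2, hR]
          have := (mem_inversions.1 h).1
          rw [e1, e2] at this
          exact this.not_gt hlr
      obtain ⟨w, hw, hc⟩ := ih _ hcard (π * adj i) rfl
      refine ⟨i :: w, ?_, fun s t hst => ?_⟩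
      · ext s : 1
        simp only [wordPerm, hw, Equiv.Perm.coe_mul, Function.comp, hadj]
      · by_cases he : s(s, t) = s(posL i, posR i)
        · have he' : s(t, s) = s(posL i, posR i) := by rw [Sym2.eq_swap, he]
          rcases Sym2.eq_iff.1 he with ⟨rfl, rfl⟩ | ⟨rfl, rfl⟩
          · have h1 := hc _ _ hlr
            simp only [crossings, he', if_true, hL, hR]
            refine ⟨?_, by rw [h1.2]⟩
            rw [h1.2, h1.1]
            simp only [Equiv.Perm.coe_mul, Function.comp, hL, hR, hi', if_true, hi'.not_gt,
              if_false]
          · exact absurd hlr hst.not_gt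
        · have he' : s(t, s) ≠ s(posL i, posR i) := by rwa [Sym2.eq_swap]
          have h1 := hc _ _ (adj_lt hst he)
          rw [hπ, hπ] at h1
          simp only [crossings, he, he', if_false, zero_add]
          exact h1

/-- Every permutation comes from a non-repeating braid. -/
theorem exists_nonRepeating (π : Equiv.Perm (Fin n)) : ∃ x ∈ D n, perm x = π := by
  obtain ⟨w, hw, hc⟩ := exists_word _ π rfl
  refine ⟨ofWord w, ⟨w, rfl, fun s t hst => ?_⟩, (perm_ofWord w).trans hw⟩
  rcases lt_or_gt_of_ne hst with h | h
  · rw [(hc _ _ h).1]; split_ifs <;> omega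
  · rw [(hc _ _ h).2, (hc _ _ h).1]; split_ifs <;> omega

/-- The non-repeating braid `R_π`. -/
noncomputable def R (π : Equiv.Perm (Fin n)) : D n :=
  ⟨Classical.choose (exists_nonRepeating π), (Classical.choose_spec (exists_nonRepeating π)).1⟩

theorem perm_R (π : Equiv.Perm (Fin n)) : perm (R π : BraidMonoid n) = π :=
  (Classical.choose_spec (exists_nonRepeating π)).2

/-! ### Thurston's operations -/

/-- The permutation `a⁻¹ ∧ ¬b`, for the permutations `a`, `b` of two non-repeating braids. -/
noncomputable def common (A B : D n) : Equiv.Perm (Fin n) :=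
  meet (perm (A : BraidMonoid n))⁻¹ (compl (perm (B : BraidMonoid n)))

/-- `R_a ≍ R_b`, the non-repeating braid of "first `a`, then `a⁻¹ ∧ ¬b`". -/
noncomputable def give (A B : D n) : D n := R (common A B * perm (A : BraidMonoid n))

/-- `R_a ⋈ R_b`, the non-repeating braid of "first `(a⁻¹ ∧ ¬b)⁻¹`, then `b`". -/
noncomputable def take (A B : D n) : D n := R (perm (B : BraidMonoid n) * (common A B)⁻¹)

/-! ### Words in Thurston's generators -/

/-- The letters: the non-repeating braids other than the trivial braid `R_ε`, which is the
identity of the monoid and is written as the empty word. -/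
def Letter (n : ℕ) : Type := {x : BraidMonoid n // x ∈ D n ∧ x ≠ 1}

open Classical in
/-- A non-repeating braid as a word: one letter, or the empty word for the trivial braid. -/
noncomputable def toWord (A : D n) : FreeMonoid (Letter n) :=
  if h : (A : BraidMonoid n) = 1 then 1 else FreeMonoid.of ⟨A, A.2, h⟩

/-- The crossings of a non-repeating braid, that is, the elements of `R_π`, listed
lexicographically. -/
def crossingList (x : BraidMonoid n) : List (Fin n ×ₗ Fin n) :=
  ((inversions (perm x)).map toLex.toEmbedding).sort (· ≤ ·)

/-- The strict deg-lex order on non-repeating braids: first compare the numbers of crossings, then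
the lists of crossings lexicographically. -/
def letterLT (x y : Letter n) : Prop :=
  List.Shortlex (· < ·) (crossingList x.1) (crossingList y.1)

/-- The strict deg-lex order on words in non-repeating braids: first compare lengths, then compare
lexicographically. -/
def wordLT (u v : FreeMonoid (Letter n)) : Prop :=
  List.Shortlex letterLT (FreeMonoid.toList u) (FreeMonoid.toList v)

/-- The relations `R_a R_b = (R_a ≍ R_b)(R_a ⋈ R_b)`, for all non-repeating braids. -/
def ThurstonRel (n : ℕ) (u v : FreeMonoid (Letter n)) : Prop :=
  ∃ A B : D n, u = toWord A * toWord B ∧ v = toWord (give A B) * toWord (take A B)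

end ThurstonBraid

namespace ThurstonBraid

variable {n : ℕ}

/-! ### The weak order on permutations -/

/-! Why it holds. Each Thurston relation moves the largest possible part `c` from the bottom of
`R_a` to the top of `R_b`, keeping `c R_b` non-repeating. If both sides differ as words, the right
side is shorter or has a first letter with fewer crossings, so the relations are oriented. All
leading words have two letters; hence nonzero compositions come only from words of three letters,
and it suffices to join the two ways of rewriting `R_a R_b R_c`.

Confluence is computed with permutations. Inverting permutations (`dperm`) makes the map from braids
multiplicative for Mathlib's product; in these terms a reduced product is `b ≼ a * b` in the weak
order, and `giveP`, `takeP` describe the relation. With the residual `res y t`, which is `(y ∨ t)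
t⁻¹`, the key is the adjunction `wle_takeP_iff`: `y ≼ takeP a b` exactly when `res y b ≼ a`. Since
residuals by a reduced product are iterated residuals (`res_mul_right`), normalizing the last two
factors in advance changes neither the last factor of the final triple (`takeP_takeP`) nor the
middle one (`takeP_giveP_giveP`). The first factor then agrees because the total product does.

For the presentation, a Matsumoto type argument (`ofWord_eq_of_wordPerm_eq`) shows that a
non-repeating braid is determined by its permutation, which gives the relations in the braid monoid.
Conversely, in Thurston's monoid a letter is the product of its elementary crossings, so the braid
relations follow. -/

/-- The permutation `π` reverses the order of `p` and `q`. -/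
def Inv (π : Equiv.Perm (Fin n)) (p q : Fin n) : Prop :=
  p ≠ q ∧ (p < q ↔ π q < π p)

/-- The weak order, `R_π₁ ⊆ R_π₂`. -/
def WLE (a b : Equiv.Perm (Fin n)) : Prop := inversions a ⊆ inversions b

infix:50 " ≼ " => WLE

theorem apply_ne {p q : Fin n} (π : Equiv.Perm (Fin n)) (h : p ≠ q) : π p ≠ π q :=
  fun e => h (π.injective e)

theorem Inv.symm {π : Equiv.Perm (Fin n)} {p q : Fin n} (h : Inv π p q) : Inv π q p := by
  have h1 := h.1
  have h2 := apply_ne π h1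
  have h3 := h.2
  exact ⟨h1.symm, by omega⟩

/-- A pair is reversed by a composite exactly when it is reversed an odd number of times. All later
facts on inversions of products rest on this cocycle identity. -/
theorem inv_mul_iff {z x : Equiv.Perm (Fin n)} {p q : Fin n} (h : p ≠ q) :
    Inv (z * x) p q ↔ ¬ (Inv x p q ↔ Inv z (x p) (x q)) := by
  have h1 := apply_ne x h
  have h2 := apply_ne z h1
  simp only [Inv, Equiv.Perm.coe_mul, Function.comp, ne_eq, h, h1, not_false_eq_true, true_and]
  omega

theorem wle_iff {a b : Equiv.Perm (Fin n)} : a ≼ b ↔ ∀ p q, Inv a p q → Inv b p q := by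
  constructor
  · intro h p q hp
    have key : ∀ p q : Fin n, p < q → Inv a p q → Inv b p q := fun p q hpq hi =>
      ⟨hpq.ne, iff_of_true hpq
        (mem_inversions.1 (h (mem_inversions.2 ⟨hpq, hi.2.1 hpq⟩ : (p, q) ∈ inversions a))).2⟩
    rcases lt_or_gt_of_ne hp.1 with hpq | hpq
    · exact key p q hpq hp
    · exact (key q p hpq hp.symm).symm
  · intro h q hq
    rw [mem_inversions] at hq ⊢
    exact ⟨hq.1, (h q.1 q.2 ⟨hq.1.ne, iff_of_true hq.1 hq.2⟩).2.1 hq.1⟩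

theorem WLE.refl (a : Equiv.Perm (Fin n)) : a ≼ a := Finset.Subset.refl _

theorem WLE.trans {a b c : Equiv.Perm (Fin n)} (h : a ≼ b) (h' : b ≼ c) : a ≼ c :=
  Finset.Subset.trans h h'

theorem inversions_injective :
    Function.Injective (inversions : Equiv.Perm (Fin n) → Finset (Fin n × Fin n)) := by
  intro a b h
  have h1 : ∀ p q, Inv a p q ↔ Inv b p q := fun p q =>
    ⟨wle_iff.1 h.subset p q, wle_iff.1 h.symm.subset p q⟩
  -- With equal inversion sets, the cocycle identity leaves `b * a⁻¹` no inversions; an increasing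
  -- permutation is the identity, as `Fin n` has only one order automorphism.
  have hm : StrictMono (b * a⁻¹ : Equiv.Perm (Fin n)) := by
    intro p q hpq
    have hne := apply_ne a⁻¹ hpq.ne
    have e := inv_mul_iff (z := b * a⁻¹) (x := a) hne
    rw [inv_mul_cancel_right] at e
    have h2 := h1 (a⁻¹ p) (a⁻¹ q)
    simp only [Equiv.Perm.inv_def, Equiv.apply_symm_apply] at e h2
    have h3 : ¬ Inv (b * a⁻¹) p q := by tauto
    have h4 := apply_ne (b * a⁻¹) hpq.ne
    simp only [Inv] at h3
    have := hpq.ne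
    omega
  have : (hm.orderIsoOfSurjective _ (b * a⁻¹).surjective) = OrderIso.refl (Fin n) :=
    Subsingleton.elim _ _
  have h2 : b * a⁻¹ = 1 := by
    ext s : 1
    exact congrArg (fun f : Fin n ≃o Fin n => f s) this
  exact (mul_inv_eq_one.1 h2).symm

theorem WLE.antisymm {a b : Equiv.Perm (Fin n)} (h : a ≼ b) (h' : b ≼ a) : a = b :=
  inversions_injective (Finset.Subset.antisymm h h')

theorem eq_of_wle_iff {a b : Equiv.Perm (Fin n)} (h : ∀ y, y ≼ a ↔ y ≼ b) : a = b :=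
  WLE.antisymm ((h a).1 (WLE.refl a)) ((h b).2 (WLE.refl b))

theorem not_inv_one (p q : Fin n) : ¬ Inv 1 p q := by
  intro h
  have h1 := h.1
  have h2 := h.2
  simp only [Equiv.Perm.coe_one, id] at h2
  omega

theorem one_wle (a : Equiv.Perm (Fin n)) : 1 ≼ a :=
  wle_iff.2 fun p q h => absurd h (not_inv_one p q)

/-- For `x ≼ w`, the inversions of `w * x⁻¹` are the images under `x` of the inversions of `w` that
`x` lacks. Removing the same set from two sets containing it preserves and reflects inclusion. -/
theorem mul_inv_wle_mul_inv_iff {x u v : Equiv.Perm (Fin n)} (hu : x ≼ u) (hv : x ≼ v) :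
    u * x⁻¹ ≼ v * x⁻¹ ↔ u ≼ v := by
  rw [wle_iff] at hu hv
  rw [wle_iff, wle_iff]
  have key : ∀ w p q, (∀ p q, Inv x p q → Inv w p q) → p ≠ q →
      (Inv (w * x⁻¹) (x p) (x q) ↔ Inv w p q ∧ ¬ Inv x p q) := by
    intro w p q hw hpq
    have := inv_mul_iff (z := w * x⁻¹) (x := x) hpq
    rw [inv_mul_cancel_right] at this
    have := hw p q
    tauto
  constructor
  · intro h p q hp
    have h1 := key u p q hu hp.1
    have h2 := key v p q hv hp.1
    have := h (x p) (x q)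
    have := hv p q
    tauto
  · intro h p q hp
    obtain ⟨p, rfl⟩ := x.surjective p
    obtain ⟨q, rfl⟩ := x.surjective q
    have hne : p ≠ q := fun e => hp.1 (e ▸ rfl)
    rw [key u p q hu hne] at hp
    rw [key v p q hv hne]
    exact ⟨h p q hp.1, hp.2⟩

/-- The condition `x ≼ z * x` thus means that the product is reduced: no pair crosses in `x` and
again in `z`. -/
theorem wle_mul_iff {z x : Equiv.Perm (Fin n)} :
    x ≼ z * x ↔ ∀ p q, Inv x p q → ¬ Inv z (x p) (x q) := by
  rw [wle_iff]
  refine forall₂_congr fun p q => ?_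
  constructor
  · intro h hp
    have := inv_mul_iff (z := z) (x := x) hp.1
    have := h hp
    tauto
  · intro h hp
    have := inv_mul_iff (z := z) (x := x) hp.1
    have := h hp
    tauto

theorem wle_mul_of_wle {x w z : Equiv.Perm (Fin n)} (hw : w ≼ z) (h : x ≼ z * x) : x ≼ w * x := by
  rw [wle_mul_iff] at h ⊢
  exact fun p q hp h' => h p q hp (wle_iff.1 hw _ _ h')

theorem mul_wle_mul_iff {x w z : Equiv.Perm (Fin n)} (hw : x ≼ w * x) (hz : x ≼ z * x) :
    w * x ≼ z * x ↔ w ≼ z := by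
  rw [← mul_inv_wle_mul_inv_iff hw hz, mul_inv_cancel_right, mul_inv_cancel_right]

/-! ### Joins and residuals -/

theorem compl_wle_compl {a b : Equiv.Perm (Fin n)} (h : a ≼ b) : compl b ≼ compl a := by
  intro q hq
  rw [mem_inversions_compl] at hq ⊢
  exact ⟨hq.1, fun h' => hq.2 (h h')⟩

theorem compl_compl (a : Equiv.Perm (Fin n)) : compl (compl a) = a := by
  ext s : 1
  simp [compl]

theorem meet_wle_left (a b : Equiv.Perm (Fin n)) : meet a b ≼ a := (meet_spec a b).1

theorem meet_wle_right (a b : Equiv.Perm (Fin n)) : meet a b ≼ b := (meet_spec a b).2.1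

theorem wle_meet {a b y : Equiv.Perm (Fin n)} (ha : y ≼ a) (hb : y ≼ b) : y ≼ meet a b :=
  (meet_spec a b).2.2 y ha hb

/-- The join in the lattice of permutations. -/
noncomputable def join (a b : Equiv.Perm (Fin n)) : Equiv.Perm (Fin n) :=
  compl (meet (compl a) (compl b))

theorem wle_join_left (a b : Equiv.Perm (Fin n)) : a ≼ join a b := by
  have := compl_wle_compl (meet_wle_left (compl a) (compl b))
  rwa [compl_compl] at this

theorem wle_join_right (a b : Equiv.Perm (Fin n)) : b ≼ join a b := by
  have := compl_wle_compl (meet_wle_right (compl a) (compl b))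
  rwa [compl_compl] at this

theorem join_wle {a b y : Equiv.Perm (Fin n)} (ha : a ≼ y) (hb : b ≼ y) : join a b ≼ y := by
  have := compl_wle_compl (wle_meet (compl_wle_compl ha) (compl_wle_compl hb))
  rwa [compl_compl] at this

theorem join_eq_left {a b : Equiv.Perm (Fin n)} (h : b ≼ a) : join a b = a :=
  WLE.antisymm (join_wle (WLE.refl a) h) (wle_join_left a b)

theorem join_comm (a b : Equiv.Perm (Fin n)) : join a b = join b a :=
  WLE.antisymm (join_wle (wle_join_right b a) (wle_join_left b a))
    (join_wle (wle_join_right a b) (wle_join_left a b))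

/-- The residual `(y ∨ t) t⁻¹`. -/
noncomputable def res (y t : Equiv.Perm (Fin n)) : Equiv.Perm (Fin n) := join y t * t⁻¹

theorem res_mul (y t : Equiv.Perm (Fin n)) : res y t * t = join y t :=
  inv_mul_cancel_right _ _

/-- Cancelling `h` in `join z h ≼ g * h` makes the residual left adjoint to multiplication by `h`,
within reduced products. -/
theorem res_wle_iff {z g h : Equiv.Perm (Fin n)} (hg : h ≼ g * h) : res z h ≼ g ↔ z ≼ g * h := by
  have h1 : h ≼ res z h * h := by rw [res_mul]; exact wle_join_right _ _
  rw [← mul_wle_mul_iff h1 hg, res_mul]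
  exact ⟨fun h => (wle_join_left _ _).trans h, fun h => join_wle h hg⟩

/-- Right multiplication by `t` identifies suitable elements with those above `t`, and so carries
the join of `res y t` and `r` to the join of `y` and `r * t`. -/
theorem res_mul_right {t r : Equiv.Perm (Fin n)} (y : Equiv.Perm (Fin n)) (ht : t ≼ r * t) :
    res y (r * t) = res (res y t) r := by
  have hm : t ≼ res y t * t := by rw [res_mul]; exact wle_join_right _ _
  have hU : t ≼ (join y (r * t) * t⁻¹) * t := by
    rw [inv_mul_cancel_right]; exact ht.trans (wle_join_right _ _)
  have hJ : join (res y t) r ≼ join y (r * t) * t⁻¹ := by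
    apply join_wle
    · rw [← mul_wle_mul_iff hm hU, res_mul, inv_mul_cancel_right]
      exact join_wle (wle_join_left _ _) (ht.trans (wle_join_right _ _))
    · rw [← mul_wle_mul_iff ht hU, inv_mul_cancel_right]
      exact wle_join_right _ _
  -- Lying below an element with a reduced product by `t`, the join has one too, so
  -- `mul_wle_mul_iff` applies to it.
  have hJt : t ≼ join (res y t) r * t := wle_mul_of_wle hJ hU
  have e : join y (r * t) = join (res y t) r * t := by
    apply WLE.antisymm
    · apply join_wle
      · have := (mul_wle_mul_iff hm hJt).2 (wle_join_left _ _)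
        rw [res_mul] at this
        exact (wle_join_left _ _).trans this
      · exact (mul_wle_mul_iff ht hJt).2 (wle_join_right _ _)
    · have := (mul_wle_mul_iff hJt hU).2 hJ
      rwa [inv_mul_cancel_right] at this
  rw [res, res, e]
  group

theorem res_mul_self {y r : Equiv.Perm (Fin n)} (h : r ≼ y * r) : res (y * r) r = y := by
  rw [res, join_eq_left h, mul_inv_cancel_right]

/-! ### Moving crossings from one factor to the next -/

/-- The largest permutation `c` such that `c` is a part of `a` and the product `c b` is reduced. -/
noncomputable def carry (a b : Equiv.Perm (Fin n)) : Equiv.Perm (Fin n) := meet a (compl b⁻¹)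

/-- The first factor, after moving `carry a b` from `a` to `b`. -/
noncomputable def giveP (a b : Equiv.Perm (Fin n)) : Equiv.Perm (Fin n) := a * (carry a b)⁻¹

/-- The second factor, after moving `carry a b` from `a` to `b`. -/
noncomputable def takeP (a b : Equiv.Perm (Fin n)) : Equiv.Perm (Fin n) := carry a b * b

/-- The inversions of `x⁻¹` are the images under `x` of those of `x`; avoiding them is what makes `z
* x` reduced. -/
theorem wle_compl_inv_iff {z x : Equiv.Perm (Fin n)} : z ≼ compl x⁻¹ ↔ x ≼ z * x := by
  have key : ∀ p q, p ≠ q → (Inv (compl x⁻¹) (x p) (x q) ↔ ¬ Inv x p q) := by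
    intro p q h
    have h1 := apply_ne x h
    simp only [Inv, compl, Equiv.Perm.coe_mul, Function.comp, Fin.revPerm_apply,
      Fin.rev_lt_rev, Equiv.Perm.inv_def, Equiv.symm_apply_apply, ne_eq, h, h1, not_false_eq_true, true_and]
    omega
  rw [wle_mul_iff, wle_iff]
  constructor
  · intro h p q hp hz
    exact (key p q hp.1).1 (h _ _ hz) hp
  · intro h p q hp
    obtain ⟨p, rfl⟩ := x.surjective p
    obtain ⟨q, rfl⟩ := x.surjective q
    have hne : p ≠ q := fun e => hp.1 (e ▸ rfl)
    exact (key p q hne).2 fun h' => h p q h' hp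

theorem carry_wle (a b : Equiv.Perm (Fin n)) : carry a b ≼ a := meet_wle_left _ _

theorem wle_takeP (a b : Equiv.Perm (Fin n)) : b ≼ takeP a b :=
  wle_compl_inv_iff.1 (meet_wle_right _ _)

theorem wle_carry {a b z : Equiv.Perm (Fin n)} (h : z ≼ a) (h' : b ≼ z * b) : z ≼ carry a b :=
  wle_meet h (wle_compl_inv_iff.2 h')

theorem giveP_mul_carry (a b : Equiv.Perm (Fin n)) : giveP a b * carry a b = a :=
  inv_mul_cancel_right _ _

theorem giveP_mul_takeP (a b : Equiv.Perm (Fin n)) : giveP a b * takeP a b = a * b := by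
  rw [takeP, ← mul_assoc, giveP_mul_carry]

/-- By this adjunction, identities between iterated `takeP` reduce to identities between residuals:
elements with the same lower bounds coincide. -/
theorem wle_takeP_iff {a b y : Equiv.Perm (Fin n)} : y ≼ takeP a b ↔ res y b ≼ a := by
  rw [takeP, ← res_wle_iff (wle_takeP a b)]
  refine ⟨fun h => h.trans (carry_wle a b), fun h => wle_carry h ?_⟩
  rw [res_mul]
  exact wle_join_right _ _

theorem carry_eq_of_reduced {a b : Equiv.Perm (Fin n)} (h : b ≼ a * b) : carry a b = a :=
  WLE.antisymm (carry_wle a b) (wle_carry (WLE.refl a) h)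

/-- The last factor of a product of three is not changed by normalizing the last two factors. -/
theorem takeP_takeP (x s t : Equiv.Perm (Fin n)) :
    takeP (takeP x (giveP s t)) (takeP s t) = takeP (takeP x s) t := by
  apply eq_of_wle_iff
  intro y
  have hs : carry s t ≼ giveP s t * carry s t := by rw [giveP_mul_carry]; exact carry_wle s t
  -- Both sides are residuals by the reduced triple product `giveP s t`, `carry s t`, `t`, bracketed
  -- in two ways.
  have e : res (res y t) s = res (res y (takeP s t)) (giveP s t) := by
    conv_lhs => rw [← giveP_mul_carry s t]
    rw [res_mul_right _ hs, takeP, res_mul_right y (wle_takeP s t)]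
  rw [wle_takeP_iff, wle_takeP_iff, wle_takeP_iff, wle_takeP_iff, e]

/-- Write `m` for `takeP x s`, `r` for `carry m t` and `j` for `s ∨ r`, which is below `m`. Both
`giveP m t` and `carry x s` have the left factor `m * j⁻¹`; moving it across the adjunction cancels
it. What remains involves only `x` and the two residuals of `s` and `r` by each other. -/
theorem wle_takeP_giveP_iff (x s t y : Equiv.Perm (Fin n)) :
    y ≼ takeP (giveP x s) (giveP (takeP x s) t) ↔
      res y (res s (carry (takeP x s) t)) ≼ x * (res (carry (takeP x s) t) s)⁻¹ := by
  set m := takeP x s with hm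
  set r := carry m t with hr
  have hsm : s ≼ m := wle_takeP x s
  have hrm : r ≼ m := carry_wle m t
  have hjm : join s r ≼ m := join_wle hsm hrm
  set j := join s r with hj
  have hrj : r ≼ j := wle_join_right _ _
  have hsj : s ≼ j := wle_join_left _ _
  have e1 : giveP m t = (m * j⁻¹) * (j * r⁻¹) := by rw [giveP, ← hr]; group
  have e2 : carry x s = (m * j⁻¹) * (j * s⁻¹) := by rw [hm, takeP]; group
  have e3 : res s r = j * r⁻¹ := rfl
  have e4 : res r s = j * s⁻¹ := by rw [res, join_comm]
  have e5 : x * (j * s⁻¹)⁻¹ = giveP x s * (m * j⁻¹) := by rw [giveP, e2]; group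
  have h1 : j * r⁻¹ ≼ (m * j⁻¹) * (j * r⁻¹) := by
    have := (mul_inv_wle_mul_inv_iff hrj hrm).2 hjm
    simpa [mul_assoc] using this
  have h2 : j * s⁻¹ ≼ carry x s := by
    have := (mul_inv_wle_mul_inv_iff hsj hsm).2 hjm
    simpa [hm, takeP] using this
  have h3 : m * j⁻¹ ≼ giveP x s * (m * j⁻¹) := by
    have := (mul_inv_wle_mul_inv_iff h2 (h2.trans (carry_wle x s))).2 (carry_wle x s)
    rw [e5] at this
    simpa [e2] using this
  rw [wle_takeP_iff, e1, e3, e4, e5, res_mul_right y h1, res_wle_iff h3]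

/-- Normalizing the last two factors of a product of three does not change the second factor
of the normal form. -/
theorem takeP_giveP_giveP (x s t : Equiv.Perm (Fin n)) :
    takeP (giveP x (giveP s t)) (giveP (takeP x (giveP s t)) (takeP s t)) =
      takeP (giveP x s) (giveP (takeP x s) t) := by
  apply eq_of_wle_iff
  intro y
  rw [wle_takeP_giveP_iff, wle_takeP_giveP_iff]
  have hT := takeP_takeP x s t
  set r := carry s t with hr
  set a := carry (takeP x (giveP s t)) (takeP s t) with ha
  set b := carry (takeP x s) t with hb
  -- What `t` receives in total is the same on both routes: equal last factors force `b * t = a * (r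
  -- * t)`.
  have hab : b = a * r := by
    have : a * (r * t) = b * t := hT
    rw [← mul_assoc] at this
    exact (mul_right_cancel this).symm
  have h1 : r ≼ a * r := by
    have e1 : t ≼ r * t := wle_takeP s t
    have e2 : t ≼ (a * r) * t := by rw [← hab]; exact wle_takeP (takeP x s) t
    rw [← mul_wle_mul_iff e1 e2, mul_assoc]
    exact wle_takeP (takeP x (giveP s t)) (takeP s t)
  have h2 : r ≼ giveP s t * r := by rw [giveP_mul_carry]; exact carry_wle s t
  have hs : s = giveP s t * r := (giveP_mul_carry s t).symm
  -- The pair `s`, `b` is the pair `giveP s t`, `a` multiplied on the right by `r`; a common reduced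
  -- right factor drops out of both residuals.
  have e1 : res s b = res (giveP s t) a := by
    conv_lhs => rw [hs, hab]
    rw [res_mul_right _ h1, res_mul_self h2]
  have e2 : res b s = res a (giveP s t) := by
    conv_lhs => rw [hs, hab]
    rw [res_mul_right _ h2, res_mul_self h1]
  rw [e1, e2]

/-! ### Non-repeating words -/

theorem posL_lt_posR (i : Fin (n - 1)) : posL i < posR i := by simp [posL, posR, Fin.lt_def]

theorem adj_posL (i : Fin (n - 1)) : adj i (posL i) = posR i := by simp [adj]

theorem adj_posR (i : Fin (n - 1)) : adj i (posR i) = posL i := by simp [adj]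

theorem adj_adj (i : Fin (n - 1)) (s : Fin n) : adj i (adj i s) = s := by simp [adj]

theorem mul_adj_adj (π : Equiv.Perm (Fin n)) (i : Fin (n - 1)) : π * adj i * adj i = π := by
  ext s : 1
  simp [adj_adj]

theorem inv_adj_iff {i : Fin (n - 1)} {s t : Fin n} (h : s ≠ t) :
    Inv (adj i) s t ↔ s(s, t) = s(posL i, posR i) := by
  constructor
  · intro hi
    by_contra hne
    rcases lt_or_gt_of_ne h with hst | hst
    · exact (hi.2.1 hst).not_gt (adj_lt hst hne)
    · rw [Sym2.eq_swap] at hne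
      exact (hi.symm.2.1 hst).not_gt (adj_lt hst hne)
  · intro e
    have key : Inv (adj i) (posL i) (posR i) :=
      ⟨(posL_lt_posR i).ne, iff_of_true (posL_lt_posR i)
        (by rw [adj_posL, adj_posR]; exact posL_lt_posR i)⟩
    rcases Sym2.eq_iff.1 e with ⟨rfl, rfl⟩ | ⟨rfl, rfl⟩
    · exact key
    · exact key.symm

/-- Each crossing of two strands exchanges their order, so parity decides inversion. In a
non-repeating word the permutation then determines the crossing numbers exactly. -/
theorem odd_crossings_iff (w : List (Fin (n - 1))) :
    ∀ {s t : Fin n}, s ≠ t → (crossings w s t % 2 = 1 ↔ Inv (wordPerm w) s t) := by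
  induction w with
  | nil => exact fun {s t} _ => iff_of_false (by simp [crossings]) (not_inv_one s t)
  | cons i w ih =>
    intro s t h
    have h1 := ih (apply_ne (adj i) h)
    rw [wordPerm, inv_mul_iff h, inv_adj_iff h, ← h1, crossings]
    split_ifs with e
    · simp only [e, true_iff]; omega
    · simp only [e, false_iff]; omega

theorem crossings_eq_one_iff {w : List (Fin (n - 1))} (hw : NonRepeatingWord w) {s t : Fin n}
    (h : s ≠ t) : crossings w s t = 1 ↔ Inv (wordPerm w) s t := by
  have := hw s t h
  rw [← odd_crossings_iff w h]
  omega

theorem crossings_append (w w' : List (Fin (n - 1))) (s t : Fin n) :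
    crossings (w ++ w') s t = crossings w s t + crossings w' (wordPerm w s) (wordPerm w t) := by
  induction w generalizing s t with
  | nil => simp [crossings, wordPerm]
  | cons i w ih => simp [crossings, wordPerm, ih, add_assoc]

theorem NonRepeatingWord.append {w w' : List (Fin (n - 1))} (hw : NonRepeatingWord w)
    (hw' : NonRepeatingWord w')
    (h : ∀ s t, Inv (wordPerm w) s t → ¬ Inv (wordPerm w') (wordPerm w s) (wordPerm w t)) :
    NonRepeatingWord (w ++ w') := by
  intro s t hst
  have h1 := hw s t hst
  have hst' := apply_ne (wordPerm w) hst
  have h2 := hw' _ _ hst'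
  have h3 := h s t
  rw [← crossings_eq_one_iff hw hst, ← crossings_eq_one_iff hw' hst'] at h3
  rw [crossings_append]
  omega

theorem nonRepeatingWord_nil : NonRepeatingWord ([] : List (Fin (n - 1))) :=
  fun _ _ _ => Nat.zero_le _

/-- The new top crossing affects only the strands entering `w` at the positions of `σ_i`; these must
not cross within `w`. -/
theorem nonRepeatingWord_cons_iff {i : Fin (n - 1)} {w : List (Fin (n - 1))} :
    NonRepeatingWord (i :: w) ↔
      NonRepeatingWord w ∧ wordPerm w (posL i) < wordPerm w (posR i) := by
  have hlr := posL_lt_posR i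
  have hne := apply_ne (wordPerm w) hlr.ne
  constructor
  · intro h
    have hw : NonRepeatingWord w := fun s t hst => by
      have := h _ _ (apply_ne (adj i) hst)
      rw [crossings, adj_adj, adj_adj] at this
      omega
    refine ⟨hw, ?_⟩
    have h1 := h _ _ hlr.ne'
    rw [crossings, adj_posL, adj_posR, if_pos Sym2.eq_swap] at h1
    by_contra hn
    have := (crossings_eq_one_iff hw hlr.ne).2
      ⟨hlr.ne, iff_of_true hlr (lt_of_le_of_ne (not_lt.1 hn) hne.symm)⟩
    omega
  · rintro ⟨hw, hi⟩ s t hst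
    have hst' := apply_ne (adj i) hst
    have h1 := hw _ _ hst'
    have h0 : ¬ Inv (wordPerm w) (posL i) (posR i) := fun h => (h.2.1 hlr).not_gt hi
    rw [crossings]
    split_ifs with e
    · have h2 := crossings_eq_one_iff hw hst'
      have : ¬ Inv (wordPerm w) (adj i s) (adj i t) := by
        rcases Sym2.eq_iff.1 e with ⟨rfl, rfl⟩ | ⟨rfl, rfl⟩
        · rw [adj_posL, adj_posR]; exact fun h => h0 h.symm
        · rwa [adj_posL, adj_posR]
      have := h2.not.2 this
      omega
    · omega

theorem wordPerm_cons_descent {i : Fin (n - 1)} {w : List (Fin (n - 1))}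
    (h : NonRepeatingWord (i :: w)) :
    wordPerm (i :: w) (posR i) < wordPerm (i :: w) (posL i) := by
  simpa [wordPerm, adj_posL, adj_posR] using (nonRepeatingWord_cons_iff.1 h).2

theorem exists_nonRepeatingWord (π : Equiv.Perm (Fin n)) :
    ∃ w, NonRepeatingWord w ∧ wordPerm w = π := by
  obtain ⟨x, ⟨w, rfl, hw⟩, hx⟩ := exists_nonRepeating π
  exact ⟨w, hw, (perm_ofWord w).symm.trans hx⟩

/-! ### Braid relations between non-repeating words of one permutation -/

theorem ofWord_append (u v : List (Fin (n - 1))) : ofWord (u ++ v) = ofWord u * ofWord v := by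
  simp [ofWord, FreeMonoid.ofList_append, map_mul]

theorem ofWord_comm {i j : Fin (n - 1)} (h : (i : ℕ) + 1 < j) (u : List (Fin (n - 1))) :
    ofWord (i :: j :: u) = ofWord (j :: i :: u) := by
  have : ofWord [i, j] = ofWord [j, i] := PresentedMonoid.mk_eq_mk_of_rel (BraidRel.comm i j h)
  have h1 := ofWord_append [i, j] u
  have h2 := ofWord_append [j, i] u
  rw [this] at h1
  exact h1.trans h2.symm

theorem ofWord_braid {i j : Fin (n - 1)} (h : (i : ℕ) + 1 = j) (u : List (Fin (n - 1))) :
    ofWord (i :: j :: i :: u) = ofWord (j :: i :: j :: u) := by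
  have : ofWord [i, j, i] = ofWord [j, i, j] :=
    PresentedMonoid.mk_eq_mk_of_rel (BraidRel.braid i j h)
  have h1 := ofWord_append [i, j, i] u
  have h2 := ofWord_append [j, i, j] u
  rw [this] at h1
  exact h1.trans h2.symm

theorem posR_eq_posL {i j : Fin (n - 1)} (h : (i : ℕ) + 1 = j) : posR i = posL j := Fin.ext h

theorem adj_apply_of_lt {i j : Fin (n - 1)} (h : i < j) : adj j (posL i) = posL i := by
  rw [Fin.lt_def] at h
  apply Equiv.swap_apply_of_ne_of_ne <;> simp [posL, posR, Fin.ext_iff] <;> omega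

theorem adj_apply_of_gt {i j : Fin (n - 1)} (h : i < j) : adj i (posR j) = posR j := by
  rw [Fin.lt_def] at h
  apply Equiv.swap_apply_of_ne_of_ne <;> simp [posL, posR, Fin.ext_iff] <;> omega

theorem adj_posR_of_lt {i j : Fin (n - 1)} (h : (i : ℕ) + 1 < j) : adj j (posR i) = posR i := by
  apply Equiv.swap_apply_of_ne_of_ne <;> simp [posL, posR, Fin.ext_iff] <;> omega

theorem adj_posL_of_gt {i j : Fin (n - 1)} (h : (i : ℕ) + 1 < j) : adj i (posL j) = posL j := by
  apply Equiv.swap_apply_of_ne_of_ne <;> simp [posL, posR, Fin.ext_iff] <;> omega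

/-- Two descents of a permutation give two words that differ by one braid relation. -/
theorem exists_words_of_descents_of_lt {π : Equiv.Perm (Fin n)} {i j : Fin (n - 1)} (hij : i < j)
    (hi : π (posR i) < π (posL i)) (hj : π (posR j) < π (posL j)) :
    ∃ u v, NonRepeatingWord (i :: u) ∧ NonRepeatingWord (j :: v) ∧ wordPerm (i :: u) = π ∧
      wordPerm (j :: v) = π ∧ ofWord (i :: u) = ofWord (j :: v) ∧ u.length = v.length := by
  rcases (show (i : ℕ) + 1 ≤ j from hij).lt_or_eq with h | h
  -- Distant crossings: strip both descents from `π`, and put them back in either order.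
  · obtain ⟨u, hu, hp⟩ := exists_nonRepeatingWord (π * adj i * adj j)
    have e := adj_comm i j h
    have p1 : wordPerm (j :: u) = π * adj i := by rw [wordPerm, hp, mul_adj_adj]
    have p2 : wordPerm (i :: u) = π * adj j := by
      rw [wordPerm, hp, mul_assoc π, ← e, ← mul_assoc, mul_adj_adj]
    refine ⟨j :: u, i :: u, ?_, ?_, ?_, ?_, ofWord_comm h u, rfl⟩
    · rw [nonRepeatingWord_cons_iff, nonRepeatingWord_cons_iff, hp, p1]
      simp [hu, adj_posL, adj_posR, adj_posL_of_gt h, adj_apply_of_gt hij, hi, hj]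
    · rw [nonRepeatingWord_cons_iff, nonRepeatingWord_cons_iff, hp, p2]
      simp [hu, adj_posL, adj_posR, adj_posR_of_lt h, adj_apply_of_lt hij, hi, hj]
    · rw [wordPerm, p1, mul_adj_adj]
    · rw [wordPerm, p2, mul_adj_adj]
  -- Adjacent crossings: both descents force the three strands involved to cross pairwise, so the
  -- triple `i j i`, equal to `j i j`, can be stripped from `π`.
  · obtain ⟨u, hu, hp⟩ := exists_nonRepeatingWord (π * adj i * adj j * adj i)
    have e := adj_braid i j h
    have hk := posR_eq_posL h
    rw [hk] at hi
    have hji := hj.trans hi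
    have hR : adj i (posL j) = posL i := by rw [← hk, adj_posR]
    have hL : adj i (posL i) = posL j := by rw [adj_posL, hk]
    have p1 : wordPerm (i :: u) = π * adj i * adj j := by rw [wordPerm, hp, mul_adj_adj]
    have p2 : wordPerm (j :: i :: u) = π * adj i := by rw [wordPerm, p1, mul_adj_adj]
    have p3 : wordPerm (j :: u) = π * adj j * adj i := by
      rw [wordPerm, hp, mul_assoc π, mul_assoc π, mul_assoc (adj i), e]
      simp only [← mul_assoc, mul_adj_adj]
    have p4 : wordPerm (i :: j :: u) = π * adj j := by rw [wordPerm, p3, mul_adj_adj]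
    refine ⟨j :: i :: u, i :: j :: u, ?_, ?_, ?_, ?_, ofWord_braid h u, rfl⟩
    · simp only [nonRepeatingWord_cons_iff, hp, p1, p2]
      simp [adj_posL, adj_posR, adj_apply_of_lt hij, adj_apply_of_gt hij, *]
    · simp only [nonRepeatingWord_cons_iff, hp, p3, p4]
      simp [adj_posL, adj_posR, adj_apply_of_lt hij, adj_apply_of_gt hij, *]
    · rw [wordPerm, p2, mul_adj_adj]
    · rw [wordPerm, p4, mul_adj_adj]

theorem exists_words_of_descents {π : Equiv.Perm (Fin n)} {i j : Fin (n - 1)} (hij : i ≠ j)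
    (hi : π (posR i) < π (posL i)) (hj : π (posR j) < π (posL j)) :
    ∃ u v, NonRepeatingWord (i :: u) ∧ NonRepeatingWord (j :: v) ∧ wordPerm (i :: u) = π ∧
      wordPerm (j :: v) = π ∧ ofWord (i :: u) = ofWord (j :: v) ∧ u.length = v.length := by
  rcases lt_or_gt_of_ne hij with h | h
  · exact exists_words_of_descents_of_lt h hi hj
  · obtain ⟨u, v, h1, h2, h3, h4, h5, h6⟩ := exists_words_of_descents_of_lt h hj hi
    exact ⟨v, u, h2, h1, h4, h3, h5.symm, h6.symm⟩

theorem wordPerm_cons_cancel {i : Fin (n - 1)} {u v : List (Fin (n - 1))}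
    (h : wordPerm (i :: u) = wordPerm (i :: v)) : wordPerm u = wordPerm v :=
  mul_right_cancel (h : wordPerm u * adj i = wordPerm v * adj i)

/-- Non-repeating words with the same permutation represent the same braid. -/
theorem ofWord_eq_of_wordPerm_eq (N : ℕ) : ∀ w w' : List (Fin (n - 1)), w.length = N →
    NonRepeatingWord w → NonRepeatingWord w' → wordPerm w = wordPerm w' →
    ofWord w = ofWord w' ∧ w.length = w'.length := by
  induction N using Nat.strong_induction_on with
  | _ N ih =>
    intro w w' hN hw hw' hp
    match w, w', hw, hw', hp, hN with
    | [], [], _, _, _, _ => exact ⟨rfl, rfl⟩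
    | [], j :: w', _, hw', hp, _ =>
      have := wordPerm_cons_descent hw'
      rw [← hp] at this
      exact absurd this (posL_lt_posR j).not_gt
    | i :: w, [], hw, _, hp, _ =>
      have := wordPerm_cons_descent hw
      rw [hp] at this
      exact absurd this (posL_lt_posR i).not_gt
    | i :: w, j :: w', hw, hw', hp, hN =>
      have hlen : w.length < N := by rw [← hN]; exact Nat.lt_succ_self _
      have hw1 := (nonRepeatingWord_cons_iff.1 hw).1
      have hw1' := (nonRepeatingWord_cons_iff.1 hw').1
      by_cases hij : i = j
      · subst hij
        obtain ⟨h1, h2⟩ := ih _ hlen w w' rfl hw1 hw1' (wordPerm_cons_cancel hp)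
        exact ⟨by rw [ofWord_cons, ofWord_cons, h1], by simp [h2]⟩
      -- Different first letters are two descents of one permutation. Induction on the tails links
      -- each word to one of two words that differ by a single braid relation.
      · have hj := wordPerm_cons_descent hw'
        rw [← hp] at hj
        obtain ⟨u, v, hu, hv, pu, pv, huv, hl⟩ :=
          exists_words_of_descents hij (wordPerm_cons_descent hw) hj
        obtain ⟨h1, h2⟩ := ih _ hlen w u rfl hw1 (nonRepeatingWord_cons_iff.1 hu).1
          (wordPerm_cons_cancel pu.symm)
        obtain ⟨h3, h4⟩ := ih _ (by omega) v w' rfl (nonRepeatingWord_cons_iff.1 hv).1 hw1'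
          (wordPerm_cons_cancel (pv.trans hp))
        refine ⟨?_, by simp only [List.length_cons]; omega⟩
        rw [ofWord_cons, h1, ← ofWord_cons, huv, ofWord_cons, h3, ← ofWord_cons]

/-- A non-repeating braid is determined by its permutation. -/
theorem D_ext {A B : D n} (h : perm (A : BraidMonoid n) = perm (B : BraidMonoid n)) : A = B := by
  obtain ⟨_, u, rfl, hu⟩ := A
  obtain ⟨_, v, rfl, hv⟩ := B
  simp only [perm_ofWord] at h
  exact Subtype.ext (ofWord_eq_of_wordPerm_eq _ u v rfl hu hv h).1

/-! ### Products of non-repeating braids -/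

/-- The inverse of the permutation of a braid, which is multiplicative. -/
def dperm (x : BraidMonoid n) : Equiv.Perm (Fin n) := (perm x)⁻¹

theorem dperm_mul (x y : BraidMonoid n) : dperm (x * y) = dperm x * dperm y := by
  simp [dperm, perm, map_mul]

theorem dperm_one : dperm (1 : BraidMonoid n) = 1 := by
  simp [dperm, perm]

theorem D_ext_dperm {A B : D n} (h : dperm (A : BraidMonoid n) = dperm (B : BraidMonoid n)) :
    A = B :=
  D_ext (inv_injective h)

theorem one_mem_D : (1 : BraidMonoid n) ∈ D n := ⟨[], rfl, nonRepeatingWord_nil⟩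

theorem dperm_give (A B : D n) :
    dperm (give A B : BraidMonoid n) = giveP (dperm (A : BraidMonoid n)) (dperm B) := by
  rw [dperm, give, perm_R, giveP, carry, common, mul_inv_rev, dperm, dperm, inv_inv]

theorem dperm_take (A B : D n) :
    dperm (take A B : BraidMonoid n) = takeP (dperm (A : BraidMonoid n)) (dperm B) := by
  rw [dperm, take, perm_R, takeP, carry, common, mul_inv_rev, inv_inv, dperm, dperm, inv_inv]

theorem inv_inv_apply_iff {x : Equiv.Perm (Fin n)} {p q : Fin n} :
    Inv x⁻¹ (x p) (x q) ↔ Inv x p q := by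
  by_cases h : p = q
  · subst h
    exact iff_of_false (fun h => h.1 rfl) (fun h => h.1 rfl)
  · have h1 := inv_mul_iff (z := x⁻¹) (x := x) h
    rw [inv_mul_cancel] at h1
    have := not_inv_one p q
    tauto

/-- Reducedness lets no pair of strands cross in both factors, so the product stays in `D`, where
the permutation identifies it. -/
theorem coe_mul_of_reduced {A B C : D n}
    (h : dperm (B : BraidMonoid n) ≼ dperm (A : BraidMonoid n) * dperm (B : BraidMonoid n))
    (hC : dperm (C : BraidMonoid n) = dperm (A : BraidMonoid n) * dperm (B : BraidMonoid n)) :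
    (A : BraidMonoid n) * B = C := by
  have hD : (A : BraidMonoid n) * B ∈ D n := by
    obtain ⟨_, u, rfl, hu⟩ := A
    obtain ⟨_, v, rfl, hv⟩ := B
    refine ⟨u ++ v, ofWord_append u v, hu.append hv fun s t hs hn => ?_⟩
    simp only [dperm, perm_ofWord] at h
    exact wle_mul_iff.1 h _ _ (inv_inv_apply_iff.2 hn) (by
      simp only [Equiv.Perm.inv_def, Equiv.symm_apply_apply]
      exact inv_inv_apply_iff.2 hs)
  have : (⟨_, hD⟩ : D n) = C := D_ext_dperm ((dperm_mul _ _).trans hC.symm)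
  exact congrArg Subtype.val this

theorem dperm_R_inv (π : Equiv.Perm (Fin n)) : dperm (R π⁻¹ : BraidMonoid n) = π := by
  rw [dperm, perm_R, inv_inv]

/-- The relations hold for positive braids. -/
theorem give_mul_take (A B : D n) :
    (give A B : BraidMonoid n) * take A B = (A : BraidMonoid n) * B := by
  -- Both `give A B` times `c` and `c` times `B` are reduced, with values `A` and `take A B`; the
  -- relation is associativity around `c`.
  set c := carry (dperm (A : BraidMonoid n)) (dperm B) with hc
  have h1 : (give A B : BraidMonoid n) * R c⁻¹ = A :=
    coe_mul_of_reduced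
      (by rw [dperm_R_inv, dperm_give, hc, giveP_mul_carry]; exact carry_wle _ _)
      (by rw [dperm_R_inv, dperm_give, hc, giveP_mul_carry])
  have h2 : (R c⁻¹ : BraidMonoid n) * B = take A B :=
    coe_mul_of_reduced (by rw [dperm_R_inv]; exact wle_takeP _ _)
      (by rw [dperm_R_inv, dperm_take]; rfl)
  rw [← h2, ← mul_assoc, h1]

theorem give_take_of_mul_mem {A B : D n} (h : (A : BraidMonoid n) * B ∈ D n)
    (hr : dperm (B : BraidMonoid n) ≼ dperm (A : BraidMonoid n) * dperm (B : BraidMonoid n)) :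
    give A B = ⟨1, one_mem_D⟩ ∧ take A B = ⟨(A : BraidMonoid n) * B, h⟩ := by
  constructor <;> apply D_ext_dperm
  · rw [dperm_give, giveP, carry_eq_of_reduced hr, mul_inv_cancel, dperm_one]
  · rw [dperm_take, takeP, carry_eq_of_reduced hr, dperm_mul]

theorem toWord_one : toWord (⟨1, one_mem_D⟩ : D n) = 1 := dif_pos rfl

theorem toWord_of_ne {A : D n} (h : (A : BraidMonoid n) ≠ 1) :
    toWord A = FreeMonoid.of ⟨A, A.2, h⟩ := dif_neg h

theorem lift_toWord (A : D n) :
    FreeMonoid.lift (fun x : Letter n => (x.1 : BraidMonoid n)) (toWord A) = A := by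
  by_cases h : (A : BraidMonoid n) = 1
  · rw [toWord, dif_pos h, map_one, h]
  · rw [toWord_of_ne h]
    exact FreeMonoid.lift_eval_of _ _

/-! ### The presentation -/

theorem nonRepeatingWord_singleton (i : Fin (n - 1)) : NonRepeatingWord [i] :=
  nonRepeatingWord_cons_iff.2 ⟨nonRepeatingWord_nil, posL_lt_posR i⟩

theorem nonRepeatingWord_pair {i j : Fin (n - 1)} (h : i ≠ j) : NonRepeatingWord [i, j] :=
  nonRepeatingWord_cons_iff.2 ⟨nonRepeatingWord_singleton j, by
    rw [wordPerm, wordPerm, one_mul]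
    refine adj_lt (posL_lt_posR i) fun e => h ?_
    rcases Sym2.eq_iff.1 e with ⟨h1, _⟩ | ⟨h1, h2⟩
    · exact Fin.ext (congrArg (fun p : Fin n => (p : ℕ)) h1)
    · have := posL_lt_posR i
      rw [h1, h2] at this
      exact absurd (posL_lt_posR j) this.not_gt⟩

theorem nonRepeatingWord_triple {i j : Fin (n - 1)} (h : (i : ℕ) + 1 = j) :
    NonRepeatingWord [i, j, i] ∧ NonRepeatingWord [j, i, j] := by
  have hij : i < j := by rw [Fin.lt_def]; omega
  have hk := posR_eq_posL h
  have hR : adj i (posL j) = posL i := by rw [← hk, adj_posR]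
  have hL : adj i (posL i) = posL j := by rw [adj_posL, hk]
  constructor
  · refine nonRepeatingWord_cons_iff.2 ⟨nonRepeatingWord_pair hij.ne', ?_⟩
    simp [wordPerm, hk, hL, adj_posL, adj_apply_of_lt hij, adj_apply_of_gt hij, posL_lt_posR]
  · refine nonRepeatingWord_cons_iff.2 ⟨nonRepeatingWord_pair hij.ne, ?_⟩
    simp [wordPerm, hR, adj_posR, adj_apply_of_lt hij, adj_apply_of_gt hij]
    rw [← hk]
    exact posL_lt_posR i

/-- The non-repeating braid of a non-repeating word. -/
def nrBraid (w : List (Fin (n - 1))) (h : NonRepeatingWord w) : D n := ⟨ofWord w, w, rfl, h⟩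

/-- The monoid presented by Thurston's relations. -/
abbrev ThurstonMonoid (n : ℕ) : Type := PresentedMonoid (ThurstonRel n)

/-- The elementary crossings, in the monoid presented by Thurston's relations. -/
noncomputable def wordHom (n : ℕ) : FreeMonoid (Fin (n - 1)) →* ThurstonMonoid n :=
  FreeMonoid.lift fun i =>
    PresentedMonoid.mk (ThurstonRel n) (toWord (nrBraid [i] (nonRepeatingWord_singleton i)))

/-- When `σ_i w` is non-repeating, the whole of `σ_i` is carried into `w`, so the relation for this
pair merges two letters into one. Induction builds each letter from elementary crossings. -/
theorem wordHom_ofList (w : List (Fin (n - 1))) (hw : NonRepeatingWord w) :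
    wordHom n (FreeMonoid.ofList w) =
      PresentedMonoid.mk (ThurstonRel n) (toWord (nrBraid w hw)) := by
  induction w with
  | nil =>
    have : nrBraid [] hw = ⟨1, one_mem_D⟩ := rfl
    rw [this, toWord_one, map_one]
    exact map_one _
  | cons i w ih =>
    obtain ⟨hw', hi⟩ := nonRepeatingWord_cons_iff.1 hw
    set S := nrBraid [i] (nonRepeatingWord_singleton i) with hS
    set W := nrBraid w hw' with hW
    have hmem : (S : BraidMonoid n) * W ∈ D n := ⟨i :: w, ofWord_append [i] w, hw⟩
    have hr : dperm (W : BraidMonoid n) ≼ dperm (S : BraidMonoid n) * dperm (W : BraidMonoid n) := by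
      rw [wle_mul_iff]
      intro p q hp hq
      have e1 : dperm (W : BraidMonoid n) = (wordPerm w)⁻¹ := congrArg _ (perm_ofWord w)
      have e2 : dperm (S : BraidMonoid n) = adj i := by
        have : dperm (S : BraidMonoid n) = (wordPerm [i])⁻¹ := congrArg _ (perm_ofWord [i])
        rw [this, wordPerm, wordPerm, one_mul, adj, Equiv.swap_inv]
      rw [e1] at hp hq
      rw [e2] at hq
      obtain ⟨s, rfl⟩ := (wordPerm w).surjective p
      obtain ⟨t, rfl⟩ := (wordPerm w).surjective q
      rw [inv_inv_apply_iff] at hp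
      simp only [Equiv.Perm.inv_def, Equiv.symm_apply_apply] at hq
      have h0 : ¬ Inv (wordPerm w) (posL i) (posR i) :=
        fun h => (h.2.1 (posL_lt_posR i)).not_gt hi
      rcases Sym2.eq_iff.1 ((inv_adj_iff hp.1).1 hq) with ⟨rfl, rfl⟩ | ⟨rfl, rfl⟩
      · exact h0 hp
      · exact h0 hp.symm
    obtain ⟨hg, ht⟩ := give_take_of_mul_mem hmem hr
    have hrel : ThurstonRel n (toWord S * toWord W) (toWord (nrBraid (i :: w) hw)) := by
      refine ⟨S, W, rfl, ?_⟩
      rw [hg, ht, toWord_one, one_mul]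
      rfl
    rw [← PresentedMonoid.mk_eq_mk_of_rel hrel, map_mul, ← ih hw', FreeMonoid.ofList_cons, map_mul]
    rfl

/-- The positive braid monoid satisfies no relations but Thurston's. -/
noncomputable def braidHom (n : ℕ) : BraidMonoid n →* ThurstonMonoid n :=
  PresentedMonoid.lift
    (fun i => PresentedMonoid.mk (ThurstonRel n)
      (toWord (nrBraid [i] (nonRepeatingWord_singleton i)))) (by
    -- Both sides of a braid relation are non-repeating words of one braid, hence both become the
    -- same letter.
    have key : ∀ u v : List (Fin (n - 1)), NonRepeatingWord u → NonRepeatingWord v →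
        ofWord u = ofWord v → wordHom n (FreeMonoid.ofList u) = wordHom n (FreeMonoid.ofList v) := by
      intro u v hu hv h
      rw [wordHom_ofList u hu, wordHom_ofList v hv]
      congr 2
      exact Subtype.ext h
    intro u v h
    have hrel := PresentedMonoid.mk_eq_mk_of_rel h
    induction h with
    | comm i j h =>
      have hne : i ≠ j := fun e => by subst e; omega
      exact key [i, j] [j, i] (nonRepeatingWord_pair hne) (nonRepeatingWord_pair hne.symm) hrel
    | braid i j h =>
      exact key [i, j, i] [j, i, j] (nonRepeatingWord_triple h).1 (nonRepeatingWord_triple h).2 hrel)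

/-- The value of a word in the letters. -/
def letterHom (n : ℕ) : FreeMonoid (Letter n) →* BraidMonoid n :=
  FreeMonoid.lift fun x : Letter n => (x.1 : BraidMonoid n)

/-- Words with equal braid values are therefore already equal modulo Thurston's relations. -/
theorem braidHom_letterHom (u : FreeMonoid (Letter n)) :
    braidHom n (letterHom n u) = PresentedMonoid.mk (ThurstonRel n) u := by
  have : (braidHom n).comp (letterHom n) = PresentedMonoid.mk (ThurstonRel n) := by
    apply FreeMonoid.hom_eq
    rintro ⟨x, ⟨w, rfl, hw⟩, hx⟩
    refine (wordHom_ofList w hw).trans ?_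
    rw [toWord_of_ne (A := nrBraid w hw) hx]
    rfl
  exact DFunLike.congr_fun this u

theorem letterHom_eq_iff (u v : FreeMonoid (Letter n)) :
    letterHom n u = letterHom n v ↔ conGen (ThurstonRel n) u v := by
  constructor
  · intro h
    rw [← PresentedMonoid.mk_eq_mk_iff, ← braidHom_letterHom, ← braidHom_letterHom, h]
  · intro h
    have hle : conGen (ThurstonRel n) ≤ Con.ker (letterHom n) := by
      rw [Con.conGen_le]
      rintro _ _ ⟨A, B, rfl, rfl⟩
      rw [Con.ker_rel, map_mul, map_mul]
      erw [lift_toWord, lift_toWord, lift_toWord, lift_toWord]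
      exact (give_mul_take A B).symm
    exact hle h

theorem letterHom_surjective : Function.Surjective (letterHom n) := by
  intro x
  induction x using PresentedMonoid.inductionOn with
  | h u =>
    induction u using FreeMonoid.inductionOn' with
    | one => exact ⟨1, map_one _⟩
    | of_mul i u ih =>
      obtain ⟨v, hv⟩ := ih
      refine ⟨toWord (nrBraid [i] (nonRepeatingWord_singleton i)) * v, ?_⟩
      rw [map_mul, map_mul, hv]
      congr 1
      exact lift_toWord _

/-! ### The orders on letters and words -/

theorem crossingList_length (x : BraidMonoid n) :
    (crossingList x).length = (inversions (perm x)).card := by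
  rw [crossingList, Finset.length_sort, Finset.card_map]

theorem crossingList_injective :
    Function.Injective fun x : Letter n => crossingList x.1 := by
  intro x y h
  have h1 := congrArg List.toFinset h
  simp only [crossingList, Finset.sort_toFinset, Finset.map_inj] at h1
  have h2 := D_ext (A := ⟨x.1, x.2.1⟩) (B := ⟨y.1, y.2.1⟩) (inversions_injective h1)
  exact Subtype.ext (Subtype.mk.inj h2)

theorem letterLT_wf : WellFounded (letterLT (n := n)) :=
  InvImage.wf _ (List.Shortlex.wf wellFounded_lt)

instance letterLT_isWellOrder : IsWellOrder (Letter n) letterLT where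
  wf := letterLT_wf
  trichotomous _ _ h h' :=
    crossingList_injective (Std.Trichotomous.trichotomous (r := List.Shortlex (· < ·)) _ _ h h')

instance wordLT_isWellOrder : IsWellOrder (FreeMonoid (Letter n)) wordLT where
  wf := InvImage.wf _ (List.Shortlex.wf letterLT_wf)
  trichotomous _ _ h h' := FreeMonoid.toList.injective
    (Std.Trichotomous.trichotomous (r := List.Shortlex letterLT) _ _ h h')

/-- Equal lengths exclude the case of a proper prefix, in which appending `t` could reverse the
comparison. -/
theorem lex_append_of_length_eq {α : Type*} {r : α → α → Prop} {l₁ l₂ : List α}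
    (h : List.Lex r l₁ l₂) (hl : l₁.length = l₂.length) (t : List α) :
    List.Lex r (l₁ ++ t) (l₂ ++ t) := by
  induction h with
  | nil => simp at hl
  | cons _ ih => exact .cons (ih (by simpa using hl))
  | rel h => exact .rel h

theorem shortlex_append {α : Type*} {r : α → α → Prop} {l₁ l₂ : List α}
    (h : List.Shortlex r l₁ l₂) (t : List α) : List.Shortlex r (l₁ ++ t) (l₂ ++ t) := by
  rcases List.shortlex_def.1 h with h | ⟨h, h'⟩
  · exact .of_length_lt (by simpa using h)
  · exact .of_lex (by simpa using h) (lex_append_of_length_eq h' h t)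

theorem wordLT_mul (a b u v : FreeMonoid (Letter n)) (h : wordLT u v) :
    wordLT (a * u * b) (a * v * b) := by
  have h1 := shortlex_append (List.Shortlex.append_left h (FreeMonoid.toList a))
    (FreeMonoid.toList b)
  exact h1

theorem isMonomialOrder_wordLT : IsMonomialOrder (wordLT (n := n)) where
  total := inferInstance
  wf := wordLT_isWellOrder.wf
  mul := wordLT_mul

/-! ### Orientation of the relations -/

theorem carry_one_right (a : Equiv.Perm (Fin n)) : carry a 1 = a :=
  carry_eq_of_reduced (one_wle _)

theorem carry_one_left (b : Equiv.Perm (Fin n)) : carry 1 b = 1 :=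
  WLE.antisymm (carry_wle 1 b) (one_wle _)

theorem give_take_of_carry_eq_one {A B : D n}
    (h : carry (dperm (A : BraidMonoid n)) (dperm (B : BraidMonoid n)) = 1) :
    give A B = A ∧ take A B = B := by
  constructor <;> apply D_ext_dperm
  · rw [dperm_give, giveP, h, inv_one, mul_one]
  · rw [dperm_take, takeP, h, one_mul]

theorem give_take_one (A : D n) :
    give A ⟨1, one_mem_D⟩ = ⟨1, one_mem_D⟩ ∧ take A ⟨1, one_mem_D⟩ = A := by
  constructor <;> apply D_ext_dperm
  · rw [dperm_give, giveP, dperm_one, carry_one_right, mul_inv_cancel]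
  · rw [dperm_take, takeP, dperm_one, carry_one_right, mul_one]

/-- A trivial left factor has nothing to give, and a trivial right factor takes everything; both
relations become equalities of words. Thus every nonzero binomial has a leading word of two letters.
-/
theorem ne_one_of_rel_ne {A B : D n}
    (h : toWord A * toWord B ≠ toWord (give A B) * toWord (take A B)) :
    (A : BraidMonoid n) ≠ 1 ∧ (B : BraidMonoid n) ≠ 1 := by
  constructor
  · intro hA
    have hA' : A = ⟨1, one_mem_D⟩ := Subtype.ext hA
    obtain ⟨h1, h2⟩ := give_take_of_carry_eq_one (A := A) (B := B)
      (by rw [hA, dperm_one, carry_one_left])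
    exact h (by rw [h1, h2])
  · intro hB
    have hB' : B = ⟨1, one_mem_D⟩ := Subtype.ext hB
    subst hB'
    obtain ⟨h1, h2⟩ := give_take_one A
    exact h (by rw [h1, h2, toWord_one, one_mul, mul_one])

/-- Since `common A B` lies below the inverse of the permutation of `A`, each of its crossings
undoes a crossing of `A` and creates none. -/
theorem perm_give_wle (A B : D n) : perm (give A B : BraidMonoid n) ≼ perm (A : BraidMonoid n) := by
  rw [give, perm_R]
  have hc : common A B ≼ (perm (A : BraidMonoid n))⁻¹ := meet_wle_left _ _
  rw [wle_iff] at hc ⊢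
  intro p q h
  have h1 := inv_mul_iff (z := common A B) (x := perm (A : BraidMonoid n)) h.1
  have h2 := hc (perm (A : BraidMonoid n) p) (perm (A : BraidMonoid n) q)
  rw [inv_inv_apply_iff] at h2
  tauto

theorem letterLT_of_wle {x y : Letter n} (h : perm x.1 ≼ perm y.1) (hne : x ≠ y) :
    letterLT x y := by
  refine .of_length_lt ?_
  rw [crossingList_length, crossingList_length]
  refine Finset.card_lt_card (h.ssubset_of_ne fun e => hne ?_)
  have := D_ext (A := ⟨x.1, x.2.1⟩) (B := ⟨y.1, y.2.1⟩) (inversions_injective e)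
  exact Subtype.ext (Subtype.mk.inj this)

theorem toWord_length_le (A : D n) : (FreeMonoid.toList (toWord A)).length ≤ 1 := by
  unfold toWord
  split_ifs
  · exact Nat.zero_le _
  · exact le_rfl

theorem wordLT_of_rel {u v : FreeMonoid (Letter n)} (h : ThurstonRel n u v) (hne : u ≠ v) :
    wordLT v u := by
  obtain ⟨A, B, rfl, rfl⟩ := h
  obtain ⟨hA, hB⟩ := ne_one_of_rel_ne hne
  have hlA := toWord_length_le (give A B)
  have hlB := toWord_length_le (take A B)
  by_cases hg : (give A B : BraidMonoid n) = 1
  · refine .of_length_lt ?_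
    have : give A B = ⟨1, one_mem_D⟩ := Subtype.ext hg
    rw [this, toWord_one, toWord_of_ne hA, toWord_of_ne hB, one_mul]
    exact Nat.lt_succ_of_le hlB
  by_cases ht : (take A B : BraidMonoid n) = 1
  · refine .of_length_lt ?_
    have : take A B = ⟨1, one_mem_D⟩ := Subtype.ext ht
    rw [this, toWord_one, toWord_of_ne hA, toWord_of_ne hB, mul_one]
    exact Nat.lt_succ_of_le hlA
  -- Both sides now have two letters, so the first letters decide. If `give A B` equals `A`, nothing
  -- is carried and the relation is trivial.
  have hgA : give A B ≠ A := by
    intro e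
    have h1 := dperm_give A B
    rw [e, giveP, left_eq_mul, inv_eq_one] at h1
    obtain ⟨h2, h3⟩ := give_take_of_carry_eq_one h1
    exact hne (by rw [h2, h3])
  rw [toWord_of_ne hA, toWord_of_ne hB, toWord_of_ne hg, toWord_of_ne ht]
  refine .of_lex rfl (.rel (letterLT_of_wle (perm_give_wle A B) fun e => hgA ?_))
  exact Subtype.ext (Subtype.mk.inj e)

/-! ### Rewriting and compositions -/

section Rewriting

variable {k : Type*} [Field k] {X : Type*} {lt : FreeMonoid X → FreeMonoid X → Prop}
  {rels : FreeMonoid X → FreeMonoid X → Prop}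

/-- `y` is obtained from `x` by applying one relation from left to right. -/
def RewriteStep (rels : FreeMonoid X → FreeMonoid X → Prop) (x y : FreeMonoid X) : Prop :=
  ∃ a u v b, rels u v ∧ x = a * u * b ∧ y = a * v * b

theorem mon_mul (u v : FreeMonoid X) : mon k (u * v) = mon k u * mon k v := map_mul _ _ _

theorem coeff_mon_self (u : FreeMonoid X) : (mon k u).coeff u = 1 := by
  simp [mon]

theorem coeff_mon_of_ne {u v : FreeMonoid X} (h : u ≠ v) : (mon k u).coeff v = 0 := by
  simp [mon, h]

theorem coeff_binomial_ne {u v w : FreeMonoid X} (h : (mon k u - mon k v).coeff w ≠ 0) :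
    w = u ∨ w = v := by
  by_contra hn
  push Not at hn
  refine h ?_
  rw [MonoidAlgebra.coeff_sub, Finsupp.sub_apply, coeff_mon_of_ne hn.1.symm,
    coeff_mon_of_ne hn.2.symm, sub_zero]

theorem coeff_binomial_left {u v : FreeMonoid X} (h : u ≠ v) :
    (mon k u - mon k v).coeff u = 1 := by
  rw [MonoidAlgebra.coeff_sub, Finsupp.sub_apply, coeff_mon_self, coeff_mon_of_ne h.symm, sub_zero]

theorem isLeadingWord_binomial {u v : FreeMonoid X} (h : u ≠ v) (hlt : lt v u) :
    IsLeadingWord lt (mon k u - mon k v) u := by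
  refine ⟨by rw [coeff_binomial_left h]; exact one_ne_zero, fun w hw hne => ?_⟩
  rcases coeff_binomial_ne hw with rfl | rfl
  · exact absurd rfl hne
  · exact hlt

theorem IsLeadingWord.unique (ho : IsMonomialOrder lt) {f : MonoidAlgebra k (FreeMonoid X)}
    {u v : FreeMonoid X} (hu : IsLeadingWord lt f u) (hv : IsLeadingWord lt f v) : u = v := by
  have := ho.total
  by_contra h
  exact asymm_of lt (hv.2 u hu.1 h) (hu.2 v hv.1 (Ne.symm h))

/-- The difference is `a (u - v) b` with leading word `x`, or zero if the relation is trivial. The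
bound on `y` allows iteration. -/
theorem trivialMod_of_rewriteStep (ho : IsMonomialOrder lt)
    (hor : ∀ u v, rels u v → u ≠ v → lt v u) {x y w : FreeMonoid X} (h : RewriteStep rels x y)
    (hw : lt x w) : TrivialMod lt (binomials k rels) w (mon k x - mon k y) ∧ lt y w := by
  have := ho.total
  obtain ⟨a, u, v, b, huv, rfl, rfl⟩ := h
  by_cases hne : u = v
  · subst hne
    refine ⟨?_, hw⟩
    rw [TrivialMod, sub_self]
    exact Submodule.zero_mem _
  · have hlt := hor u v huv hne
    refine ⟨Submodule.subset_span ⟨mon k u - mon k v, ⟨u, v, huv, hne, rfl⟩, a, u, b,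
      isLeadingWord_binomial hne hlt, hw, ?_⟩, _root_.trans (ho.mul a b _ _ hlt) hw⟩
    simp only [mon_mul, mul_sub, sub_mul]

theorem trivialMod_of_rewrite (ho : IsMonomialOrder lt)
    (hor : ∀ u v, rels u v → u ≠ v → lt v u) {x y w : FreeMonoid X}
    (h : Relation.ReflTransGen (RewriteStep rels) x y) (hw : lt x w) :
    TrivialMod lt (binomials k rels) w (mon k x - mon k y) := by
  induction h using Relation.ReflTransGen.head_induction_on with
  | refl =>
    rw [TrivialMod, sub_self]
    exact Submodule.zero_mem _
  | head h _ ih =>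
    obtain ⟨h1, h2⟩ := trivialMod_of_rewriteStep (k := k) ho hor h hw
    have := Submodule.add_mem _ h1 (ih h2)
    rwa [sub_add_sub_cancel] at this

/-- Rewriting never increases a word, so both paths to the common word stay below `w`. -/
theorem trivialMod_of_joinable (ho : IsMonomialOrder lt)
    (hor : ∀ u v, rels u v → u ≠ v → lt v u) {x y z w : FreeMonoid X}
    (hx : Relation.ReflTransGen (RewriteStep rels) x z)
    (hy : Relation.ReflTransGen (RewriteStep rels) y z) (hxw : lt x w) (hyw : lt y w) :
    TrivialMod lt (binomials k rels) w (mon k x - mon k y) := by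
  have := Submodule.sub_mem _ (trivialMod_of_rewrite (k := k) ho hor hx hxw)
    (trivialMod_of_rewrite ho hor hy hyw)
  rwa [sub_sub_sub_cancel_right] at this

end Rewriting

/-! ### Overlaps of words of two letters -/

theorem overlap_cases {α : Type*} {x y z t : α} {a b : List α} (h : [x, y] ++ b = a ++ [z, t])
    (hl : b.length < 2) : (a = [] ∧ b = [] ∧ x = z ∧ y = t) ∨ (a = [x] ∧ b = [t] ∧ y = z) := by
  have hlen := congrArg List.length h
  simp only [List.length_append, List.length_cons, List.length_nil] at hlen
  match a, b with
  | [], [] => simpa using h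
  | [], _ :: _ => simp at hlen
  | [_], [] => simp at hlen
  | [_], [_] => simp_all
  | [_], _ :: _ :: _ => simp only [List.length_cons] at hl; omega
  | _ :: _ :: _, _ => simp at hlen; omega

/-! ### Confluence on words of three letters -/

/-- The word of three non-repeating braids. -/
noncomputable def tripleWord (A B C : D n) : FreeMonoid (Letter n) :=
  toWord A * toWord B * toWord C

theorem rewriteStep_left (A B C : D n) :
    RewriteStep (ThurstonRel n) (tripleWord A B C) (tripleWord (give A B) (take A B) C) :=
  ⟨1, _, _, toWord C, ⟨A, B, rfl, rfl⟩, by rw [tripleWord, one_mul], by rw [tripleWord, one_mul]⟩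

theorem rewriteStep_right (A B C : D n) :
    RewriteStep (ThurstonRel n) (tripleWord A B C) (tripleWord A (give B C) (take B C)) :=
  ⟨toWord A, _, _, 1, ⟨B, C, rfl, rfl⟩, by rw [tripleWord, mul_one, mul_assoc],
    by rw [tripleWord, mul_one, mul_assoc]⟩

/-- The result of normalizing the first two factors, then the last two, then the first two. -/
noncomputable def tripleNormal (A B C : D n) : FreeMonoid (Letter n) :=
  tripleWord (give (give A B) (give (take A B) C)) (take (give A B) (give (take A B) C))
    (take (take A B) C)

theorem rewrite_tripleNormal (A B C : D n) :
    Relation.ReflTransGen (RewriteStep (ThurstonRel n)) (tripleWord (give A B) (take A B) C)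
      (tripleNormal A B C) :=
  (Relation.ReflTransGen.single (rewriteStep_right _ _ _)).tail (rewriteStep_left _ _ _)

/-- This is the confluence statement: starting with the last two factors leads to the same normal
triple. Two factors agree by the `takeP` identities, the first by cancelling them from the common
product. -/
theorem tripleNormal_give_take (A B C : D n) :
    tripleNormal A (give B C) (take B C) = tripleNormal A B C := by
  have h3 := takeP_takeP (dperm (A : BraidMonoid n)) (dperm (B : BraidMonoid n)) (dperm C)
  have h2 := takeP_giveP_giveP (dperm (A : BraidMonoid n)) (dperm (B : BraidMonoid n)) (dperm C)
  have e3 : take (take A (give B C)) (take B C) = take (take A B) C := by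
    apply D_ext_dperm
    simpa only [dperm_take, dperm_give] using h3
  have e2 : take (give A (give B C)) (give (take A (give B C)) (take B C)) =
      take (give A B) (give (take A B) C) := by
    apply D_ext_dperm
    simpa only [dperm_take, dperm_give] using h2
  have prod : ∀ x s t : Equiv.Perm (Fin n),
      giveP (giveP x s) (giveP (takeP x s) t) * takeP (giveP x s) (giveP (takeP x s) t) *
        takeP (takeP x s) t = x * (s * t) := by
    intro x s t
    rw [giveP_mul_takeP, mul_assoc, giveP_mul_takeP, ← mul_assoc, giveP_mul_takeP, mul_assoc]
  have e1 : give (give A (give B C)) (give (take A (give B C)) (take B C)) =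
      give (give A B) (give (take A B) C) := by
    apply D_ext_dperm
    simp only [dperm_take, dperm_give]
    have h := prod (dperm (A : BraidMonoid n)) (giveP (dperm (B : BraidMonoid n)) (dperm C))
      (takeP (dperm (B : BraidMonoid n)) (dperm C))
    have h' := prod (dperm (A : BraidMonoid n)) (dperm (B : BraidMonoid n)) (dperm C)
    rw [giveP_mul_takeP (dperm (B : BraidMonoid n)), ← h', h3, h2] at h
    exact mul_right_cancel (mul_right_cancel h)
  rw [tripleNormal, tripleNormal, e1, e2, e3]

/-- A nontrivial non-repeating braid, as a letter. -/
def toLetter (A : D n) (h : (A : BraidMonoid n) ≠ 1) : Letter n := ⟨A, A.2, h⟩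

theorem toLetter_inj {A B : D n} {hA : (A : BraidMonoid n) ≠ 1} {hB : (B : BraidMonoid n) ≠ 1}
    (h : toLetter A hA = toLetter B hB) : A = B :=
  Subtype.ext (Subtype.mk.inj h)

/-! ### Compositions of Thurston's binomials -/

variable {k : Type*} [Field k]

theorem exists_of_mem_binomials {f : MonoidAlgebra k (FreeMonoid (Letter n))}
    (hf : f ∈ binomials k (ThurstonRel n)) :
    ∃ (A B : D n) (hA : (A : BraidMonoid n) ≠ 1) (hB : (B : BraidMonoid n) ≠ 1),
      f = mon k (toWord A * toWord B) - mon k (toWord (give A B) * toWord (take A B)) ∧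
      wordLT (toWord (give A B) * toWord (take A B)) (toWord A * toWord B) ∧
      IsLeadingWord wordLT f (toWord A * toWord B) ∧ f.coeff (toWord A * toWord B) = 1 ∧
      FreeMonoid.toList (toWord A * toWord B) = [toLetter A hA, toLetter B hB] := by
  obtain ⟨_, _, ⟨A, B, rfl, rfl⟩, hne, rfl⟩ := hf
  obtain ⟨hA, hB⟩ := ne_one_of_rel_ne hne
  have hlt := wordLT_of_rel ⟨A, B, rfl, rfl⟩ hne
  refine ⟨A, B, hA, hB, rfl, hlt, isLeadingWord_binomial hne hlt, coeff_binomial_left hne, ?_⟩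
  rw [toWord_of_ne hA, toWord_of_ne hB]
  rfl

theorem isGroebnerShirshovBasis_binomials :
    IsGroebnerShirshovBasis (wordLT (n := n)) (binomials k (ThurstonRel n)) where
  order := isMonomialOrder_wordLT
  monic f hf := by
    obtain ⟨A, B, _, _, _, _, h1, h2, _⟩ := exists_of_mem_binomials hf
    exact ⟨_, h1, h2⟩
  intersection f hf g hg u v a b w hu hv hw hw' hl := by
    obtain ⟨A, B, hA, hB, rfl, hltf, hlf, _, hfl⟩ := exists_of_mem_binomials hf
    obtain ⟨A', B', hA', hB', rfl, hltg, hlg, _, hgl⟩ := exists_of_mem_binomials hg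
    obtain rfl := hu.unique isMonomialOrder_wordLT hlf
    obtain rfl := hv.unique isMonomialOrder_wordLT hlg
    have h : [toLetter A hA, toLetter B hB] ++ FreeMonoid.toList b =
        FreeMonoid.toList a ++ [toLetter A' hA', toLetter B' hB'] := by
      rw [← hfl, ← hgl, ← FreeMonoid.toList_mul, ← FreeMonoid.toList_mul, ← hw, ← hw']
    have hb : (FreeMonoid.toList b).length < 2 := by
      have h1 := congrArg List.length hfl
      have h2 := congrArg List.length hgl
      have h3 := congrArg FreeMonoid.length hw
      rw [FreeMonoid.length_mul] at h3
      change FreeMonoid.length _ = 2 at h1 h2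
      change FreeMonoid.length b < 2
      omega
    -- With complete overlap, the leading word determines its relation, so both binomials coincide
    -- and the composition is zero. Otherwise one letter is shared.
    rcases overlap_cases h hb with ⟨ha, hb, h1, h2⟩ | ⟨ha, hb, h1⟩
    · obtain rfl := toLetter_inj h1
      obtain rfl := toLetter_inj h2
      have ha : a = 1 := FreeMonoid.toList.injective ha
      have hb : b = 1 := FreeMonoid.toList.injective hb
      subst ha hb
      rw [TrivialMod, show mon k (1 : FreeMonoid (Letter n)) = 1 from map_one _, mul_one, one_mul,
        sub_self]
      exact Submodule.zero_mem _
    · obtain rfl := toLetter_inj h1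
      have ha : a = toWord A := FreeMonoid.toList.injective (by rw [ha, toWord_of_ne hA]; rfl)
      have hb : b = toWord B' := FreeMonoid.toList.injective (by rw [hb, toWord_of_ne hB']; rfl)
      subst ha hb
      have e : (mon k (toWord A * toWord B) - mon k (toWord (give A B) * toWord (take A B))) *
            mon k (toWord B') - mon k (toWord A) * (mon k (toWord B * toWord B') -
              mon k (toWord (give B B') * toWord (take B B'))) =
          mon k (tripleWord A (give B B') (take B B')) -
            mon k (tripleWord (give A B) (take A B) B') := by
        simp only [tripleWord, mon_mul, sub_mul, mul_sub, mul_assoc]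
        abel
      rw [e]
      -- After the right-hand start, one step on the first two factors reaches the path to the
      -- normal triple, which is that of the left-hand start by `tripleNormal_give_take`.
      have hr := rewrite_tripleNormal A (give B B') (take B B')
      rw [tripleNormal_give_take] at hr
      refine trivialMod_of_joinable isMonomialOrder_wordLT (fun u v => wordLT_of_rel)
        (.head (rewriteStep_left _ _ _) hr) (rewrite_tripleNormal A B B') ?_ ?_
      · have := wordLT_mul (toWord A) 1 _ _ hltg
        rw [mul_one, mul_one, ← hw'] at this
        rwa [tripleWord, mul_assoc]
      · have := wordLT_mul 1 (toWord B') _ _ hltf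
        rwa [one_mul, one_mul, ← hw] at this
  inclusion f hf g hg u v a b hu hv huv := by
    obtain ⟨A, B, hA, hB, rfl, hltf, hlf, _, hfl⟩ := exists_of_mem_binomials hf
    obtain ⟨A', B', hA', hB', rfl, hltg, hlg, _, hgl⟩ := exists_of_mem_binomials hg
    obtain rfl := hu.unique isMonomialOrder_wordLT hlf
    obtain rfl := hv.unique isMonomialOrder_wordLT hlg
    -- All leading words have length two, so inclusion forces equality of the leading words and
    -- hence of the relations.
    have h1 : FreeMonoid.length (toWord A * toWord B) = 2 := congrArg List.length hfl
    have h2 : FreeMonoid.length (toWord A' * toWord B') = 2 := congrArg List.length hgl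
    have h3 := congrArg FreeMonoid.length huv
    rw [h1, FreeMonoid.length_mul, FreeMonoid.length_mul, h2] at h3
    have ha : a = 1 := FreeMonoid.length_eq_zero.1 (by omega)
    have hb : b = 1 := FreeMonoid.length_eq_zero.1 (by omega)
    subst ha hb
    rw [one_mul, mul_one] at huv
    have h4 := congrArg FreeMonoid.toList huv
    rw [hfl, hgl] at h4
    obtain ⟨h5, h6⟩ := List.cons.inj h4
    obtain rfl := toLetter_inj h5
    obtain rfl := toLetter_inj (List.cons.inj h6).1
    rw [TrivialMod, show mon k (1 : FreeMonoid (Letter n)) = 1 from map_one _, mul_one, one_mul,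
      sub_self]
    exact Submodule.zero_mem _

end ThurstonBraid

theorem mainTheorem2 (k : Type*) [Field k] (n : ℕ) :
    ThurstonBraid.IsGroebnerShirshovBasisOfMonoid k
      (fun x : ThurstonBraid.Letter n => (x.1 : ThurstonBraid.BraidMonoid n))
      ThurstonBraid.wordLT (ThurstonBraid.ThurstonRel n) := by
  exact
    { generates := ThurstonBraid.letterHom_surjective
      presents := ThurstonBraid.letterHom_eq_iff
      oriented := fun _ _ => ThurstonBraid.wordLT_of_rel
      basis := ThurstonBraid.isGroebnerShirshovBasis_binomials }
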